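/- Let $d\ge 2$ and let $\omega$ be a non-principal ultrafilter on $\mathbb N$. Let $\mathrm{Rat}_d(\mathbb C)$ be the space of rational maps $[z_0:z_1]\mapsto[P(z_0,z_1):Q(z_0,z_1)]$ of degree $d$ of $\mathbb P^1(\mathbb C)$, where $P,Q$ are homogeneous of degree $d$ without common factor, viewed as a subspace of $\mathbb P^{2d+1}(\mathbb C)$ through the coefficients of $P$ and $Q$. Let $\mathrm{Rat}_d(\mathbb C)/\mathrm{PGL}_2(\mathbb C)$ be the moduli space of conjugacy classes, with the quotient topology. A scale is an equivalence class of sequences in $(0,1]$, where $(\epsilon_n)$ and $(\epsilon_n')$ are equivalent if and only if $\lim_\omega \epsilon_n/\epsilon_n'\in(0,\infty)$. The trivial scale is the class of the constant sequence $1$. Let $(f_n)_{n\in\mathbb N}$ be a sequence in $\mathrm{Rat}_d(\mathbb C)$ that degenerates in moduli space, i.e. the conjugacy classes $[f_n]$ eventually leave every compact subset of $\mathrm{Rat}_d(\mathbb C)/\mathrm{PGL}_2(\mathbb C)$. For an integer $l\ge1$ and a sequence $p=(p_n)_{n\in\mathbb N}$ of points of $\mathbb P^1(\mathbb C)$ such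 that each $p_n$ is a periodic point of $f_n$ whose period divides $l$, put \[ \lambda(f_n,p_n)=\frac1l\,\log^+\bigl|(f_n^l)'(p_n)\bigr|,\qquad \eta_{p,n}=\frac1{1+\lambda(f_n,p_n)}, \] and call the scale represented by $(\eta_{p,n})_{n\in\mathbb N}$ the multiplier scale of $p$. Then, over all $l\ge1$ and all such sequences $p$, there are at most $2d-2$ distinct non-trivial multiplier scales. In particular, the total number of distinct multiplier scales is at most $2d-1$. -/

import Mathlib

noncomputable section

namespace MultiplierScales

/-- The binary form `∑ aᵢ z₀ⁱ z₁^(d-i)` of degree `d` with coefficients `a₀, …, a_d`. -/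
def form {d : ℕ} (a : Fin (d + 1) → ℂ) : MvPolynomial (Fin 2) ℂ :=
  ∑ i : Fin (d + 1),
    MvPolynomial.C (a i) * MvPolynomial.X 0 ^ (i : ℕ) * MvPolynomial.X 1 ^ (d - (i : ℕ))

/-- The point `[x : y]` of the Riemann sphere `OnePoint ℂ`, where `[1 : 0] = ∞` and `[z : 1] = z`. -/
def point (x y : ℂ) : OnePoint ℂ :=
  open Classical in if y = 0 then OnePoint.infty else ((x / y : ℂ) : OnePoint ℂ)

/-- Homogeneous coordinates of a point of the sphere. -/
def homog (p : OnePoint ℂ) : Fin 2 → ℂ :=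
  p.elim ![1, 0] (fun z => ![z, 1])

/-- Coefficients `(a, b)` of pairs `(P, Q)` of binary forms of degree `d` without common factor,
a subspace of `ℂ^(d+1) × ℂ^(d+1)`. -/
abbrev CoprimePair (d : ℕ) : Type :=
  {c : (Fin (d + 1) → ℂ) × (Fin (d + 1) → ℂ) // IsRelPrime (form c.1) (form c.2)}

/-- The self-map `[z₀ : z₁] ↦ [P(z₀, z₁) : Q(z₀, z₁)]` of the sphere. -/
def CoprimePair.toFun {d : ℕ} (c : CoprimePair d) : OnePoint ℂ → OnePoint ℂ := fun p =>
  point (MvPolynomial.eval (homog p) (form c.1.1)) (MvPolynomial.eval (homog p) (form c.1.2))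

/-- The space of rational maps of degree `d` of the Riemann sphere. -/
def RatMap (d : ℕ) : Type :=
  {f : OnePoint ℂ → OnePoint ℂ // ∃ c : CoprimePair d, c.toFun = f}

/-- The rational map with given coefficients. -/
def RatMap.ofCoeffs {d : ℕ} (c : CoprimePair d) : RatMap d := ⟨c.toFun, c, rfl⟩

/-- Two coprime pairs define the same rational map iff they are proportional, so this is the
topology of an open subset of the projective space of the `2d + 2` coefficients. -/
instance (d : ℕ) : TopologicalSpace (RatMap d) :=
  TopologicalSpace.coinduced RatMap.ofCoeffs inferInstance

/-- Conjugacy of rational maps by Möbius transformations: `g = M⁻¹ ∘ f ∘ M`. -/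
instance conjugacy (d : ℕ) : Setoid (RatMap d) where
  r f g := ∃ M : GL (Fin 2) ℂ, ∀ z : OnePoint ℂ, g.1 z = M⁻¹ • f.1 (M • z)
  iseqv :=
    { refl := fun f => ⟨1, fun z => by simp⟩
      symm := by
        rintro f g ⟨M, h⟩
        exact ⟨M⁻¹, fun z => by simp [h]⟩
      trans := by
        rintro f g k ⟨M, h⟩ ⟨N, h'⟩
        exact ⟨M * N, fun z => by simp [h, h', mul_smul]⟩ }

/-- The moduli space of rational maps of degree `d`, with the quotient topology. -/
abbrev Moduli (d : ℕ) : Type := Quotient (conjugacy d)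

/-- The sequence of conjugacy classes `[fₙ]` eventually leaves every compact subset of the moduli
space. -/
def Degenerates {d : ℕ} (f : ℕ → RatMap d) : Prop :=
  ∀ K : Set (Moduli d), IsCompact K →
    ∀ᶠ n in Filter.atTop, (Quotient.mk (conjugacy d) (f n)) ∉ K

/-- The coordinate `z` near a finite point of the sphere (the value at `∞` is irrelevant). -/
def coord (p : OnePoint ℂ) : ℂ := p.elim 0 id

/-- The coordinate `w = 1 / z` near `∞` (the value at `0` is irrelevant). -/
def coordInfty (p : OnePoint ℂ) : ℂ := p.elim 0 (fun z => z⁻¹)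

/-- The derivative `g'(p)` of a self-map `g` of the sphere at a fixed point `p`, computed in the
coordinate `z` if `p` is finite and in the coordinate `w = 1 / z` if `p = ∞`. -/
def derivAtFixedPt (g : OnePoint ℂ → OnePoint ℂ) (p : OnePoint ℂ) : ℂ :=
  p.elim (deriv (fun w : ℂ => coordInfty (g (point 1 w))) 0)
    (fun z => deriv (fun w : ℂ => coord (g (point w 1))) z)

/-- `λ(f, p) = (1 / l) log⁺ |(f^l)'(p)|` for a point `p` with `f^l(p) = p`. -/
def lam {d : ℕ} (f : RatMap d) (l : ℕ) (p : OnePoint ℂ) : ℝ :=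
  1 / (l : ℝ) * Real.posLog ‖derivAtFixedPt (f.1^[l]) p‖

theorem lam_nonneg {d : ℕ} (f : RatMap d) (l : ℕ) (p : OnePoint ℂ) : 0 ≤ lam f l p :=
  mul_nonneg (by positivity) Real.posLog_nonneg

/-- Two sequences in `(0, 1]` represent the same scale iff the limit of their quotient along `ω`
lies in `(0, ∞)`. -/
def scaleSetoid (ω : Ultrafilter ℕ) : Setoid (ℕ → Set.Ioc (0 : ℝ) 1) where
  r ε η := ∃ c : ℝ, 0 < c ∧
    Filter.Tendsto (fun n => (ε n : ℝ) / (η n : ℝ)) (ω : Filter ℕ) (nhds c)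
  iseqv :=
    { refl := fun ε => ⟨1, one_pos, by
        have h : ∀ n, (ε n : ℝ) / (ε n : ℝ) = 1 := fun n => div_self (ε n).2.1.ne'
        simp [h]⟩
      symm := by
        rintro ε η ⟨c, hc, h⟩
        exact ⟨c⁻¹, inv_pos.2 hc, by simpa using h.inv₀ hc.ne'⟩
      trans := by
        rintro ε η θ ⟨c, hc, h⟩ ⟨e, he, h'⟩
        refine ⟨c * e, mul_pos hc he, (h.mul h').congr fun n => ?_⟩
        exact div_mul_div_cancel₀ (η n).2.1.ne' }

/-- Scales with respect to the ultrafilter `ω`. -/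
abbrev Scale (ω : Ultrafilter ℕ) : Type := Quotient (scaleSetoid ω)

/-- The trivial scale, represented by the constant sequence `1`. -/
def trivialScale (ω : Ultrafilter ℕ) : Scale ω :=
  Quotient.mk (scaleSetoid ω) fun _ => ⟨1, one_pos, le_rfl⟩

/-- The scale represented by `1 / (1 + λ(fₙ, pₙ))`. -/
def multiplierScale (ω : Ultrafilter ℕ) {d : ℕ} (f : ℕ → RatMap d) (l : ℕ)
    (p : ℕ → OnePoint ℂ) : Scale ω :=
  Quotient.mk (scaleSetoid ω) fun n => ⟨1 / (1 + lam (f n) l (p n)),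
    by have := lam_nonneg (f n) l (p n); positivity,
    by
      have := lam_nonneg (f n) l (p n)
      rw [div_le_one (by positivity)]
      linarith⟩

/-- The set of all multiplier scales of `(fₙ)`: over all `l ≥ 1` and all sequences `(pₙ)` such
that `pₙ` is a periodic point of `fₙ` whose period divides `l`. -/
def multiplierScales (ω : Ultrafilter ℕ) {d : ℕ} (f : ℕ → RatMap d) : Set (Scale ω) :=
  {s | ∃ l : ℕ, 1 ≤ l ∧ ∃ p : ℕ → OnePoint ℂ,
    (∀ n, Function.IsPeriodicPt (f n).1 l (p n)) ∧ s = multiplierScale ω f l p}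

end MultiplierScales

end

/-! Germs of complex sequences along `ω` form a field of characteristic zero, and the count is a
transcendence degree bound in this field.

A rational map of degree `d ≥ 2` can be conjugated to a normal form whose coefficients lie in a ring
generated by `2d - 2` elements, the dimension of moduli space (`exists_conj_normalForm`,
`exists_generators`). Since `ω` decides every finite alternative, the germs of the coefficients of a
sequence of normal forms are still generated by `2d - 2` germs.

Multipliers are conjugacy invariants and algebraic functions of the coefficients. If `F` is the
homogeneous lift and `F^l(v) = μ v`, then the Jacobian of `F^l` at `v` has trace `μ (d^l + ρ)`,
where `ρ` is the multiplier. Hence the germ of a sequence of multipliers is algebraic over the `2d -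
2` generators (`multiplier_germ_mem`).

Non-trivial, pairwise distinct scales mean that the quantities `log |ρ|` tend to infinity at
pairwise incomparable rates. Then distinct monomials in the multipliers have sizes whose ratio tends
to `0` or `∞`, so one monomial of a polynomial relation would outweigh all the others: the
multipliers are algebraically independent (`algebraicIndependent_of_growth`). There are thus at most
`2d - 2` of them (`card_le_of_algebraicIndependent`). -/

noncomputable section

namespace MultiplierScales

section

open Finset Polynomial

/-! ### Binary forms over a commutative ring, and their iterates -/

section PairMap

variable {R S : Type*} [CommRing R] [CommRing S]

/-- The value of the binary form `∑ aᵢ xⁱ y^(d-i)`. -/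
def evalForm (d : ℕ) (a : ℕ → R) (x y : R) : R :=
  ∑ i ∈ range (d + 1), a i * x ^ i * y ^ (d - i)

/-- The map `(x, y) ↦ (P(x, y), Q(x, y))` given by two binary forms of degree `d`. -/
def pairMap (d : ℕ) (a b : ℕ → R) (v : R × R) : R × R :=
  (evalForm d a v.1 v.2, evalForm d b v.1 v.2)

theorem map_evalForm (φ : R →+* S) (d : ℕ) (a : ℕ → R) (x y : R) :
    φ (evalForm d a x y) = evalForm d (fun i => φ (a i)) (φ x) (φ y) := by
  simp [evalForm]

/-- Iterates are polynomial in the coefficients and the point, hence commute with ring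
homomorphisms. This is applied to evaluation of polynomials, to the `n`-th term of a sequence, to
germs, and to inclusions of subrings. -/
theorem map_pairMap_iterate (φ : R →+* S) (d : ℕ) (a b : ℕ → R) (l : ℕ) (v : R × R) :
    Prod.map φ φ ((pairMap d a b)^[l] v) =
      (pairMap d (fun i => φ (a i)) (fun i => φ (b i)))^[l] (Prod.map φ φ v) := by
  have h : Function.Semiconj (Prod.map φ φ) (pairMap d a b)
      (pairMap d (fun i => φ (a i)) (fun i => φ (b i))) := fun v => by
    simp [pairMap, map_evalForm]
  exact (h.iterate_right l) v

theorem evalForm_smul (d : ℕ) (a : ℕ → R) (s x y : R) :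
    evalForm d a (s * x) (s * y) = s ^ d * evalForm d a x y := by
  rw [evalForm, evalForm, mul_sum]
  refine sum_congr rfl fun i hi => ?_
  have hi' : i + (d - i) = d := Nat.add_sub_cancel' (Nat.lt_succ_iff.1 (mem_range.1 hi))
  calc a i * (s * x) ^ i * (s * y) ^ (d - i)
      = s ^ (i + (d - i)) * (a i * x ^ i * y ^ (d - i)) := by ring
    _ = _ := by rw [hi']

theorem pairMap_smul (d : ℕ) (a b : ℕ → R) (s : R) (v : R × R) :
    pairMap d a b (s • v) = s ^ d • pairMap d a b v := by
  simp [pairMap, evalForm_smul]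

theorem pairMap_iterate_smul (d : ℕ) (a b : ℕ → R) (l : ℕ) (s : R) (v : R × R) :
    (pairMap d a b)^[l] (s • v) = s ^ d ^ l • (pairMap d a b)^[l] v := by
  induction l generalizing s v with
  | zero => simp
  | succ l ih => rw [Function.iterate_succ_apply, pairMap_smul, ih, Function.iterate_succ_apply,
      pow_succ', pow_mul]

theorem evalForm_one_zero (d : ℕ) (a : ℕ → R) : evalForm d a 1 0 = a d := by
  rw [evalForm, sum_range_succ, sum_eq_zero]
  · simp
  · intro i hi
    rw [zero_pow (by have := mem_range.1 hi; omega), mul_zero]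

theorem evalForm_zero_one (d : ℕ) (a : ℕ → R) : evalForm d a 0 1 = a 0 := by
  rw [evalForm, sum_range_succ', sum_eq_zero]
  · simp
  · simp

theorem pairMap_congr {d : ℕ} {a b a' b' : ℕ → R} (ha : ∀ i ≤ d, a i = a' i)
    (hb : ∀ i ≤ d, b i = b' i) : pairMap d a b = pairMap d a' b' := by
  funext v
  simp only [pairMap, evalForm]
  congr 1 <;> refine sum_congr rfl fun i hi => ?_
  · rw [ha i (Nat.lt_succ_iff.1 (mem_range.1 hi))]
  · rw [hb i (Nat.lt_succ_iff.1 (mem_range.1 hi))]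

/-- The two components of the iterate of a pair of forms along the line `(X, 1)`. -/
def linePoly (d : ℕ) (a b : ℕ → R) (l : ℕ) : R[X] × R[X] :=
  (pairMap d (fun i => C (a i)) (fun i => C (b i)))^[l] (X, 1)

theorem eval_linePoly (d : ℕ) (a b : ℕ → R) (l : ℕ) (z : R) :
    ((linePoly d a b l).1.eval z, (linePoly d a b l).2.eval z) = (pairMap d a b)^[l] (z, 1) := by
  have := map_pairMap_iterate (evalRingHom z) d (fun i => C (a i)) (fun i => C (b i)) l (X, 1)
  simpa [linePoly, Prod.map] using this

theorem map_linePoly (φ : R →+* S) (d : ℕ) (a b : ℕ → R) (l : ℕ) :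
    Prod.map (mapRingHom φ) (mapRingHom φ) (linePoly d a b l) =
      linePoly d (fun i => φ (a i)) (fun i => φ (b i)) l := by
  have := map_pairMap_iterate (mapRingHom φ) d (fun i => C (a i)) (fun i => C (b i)) l (X, 1)
  simpa [linePoly, Prod.map] using this

/-- The polynomial whose roots are the finite fixed points of an iterate of a pair of forms. -/
def fixedPoly (d : ℕ) (a b : ℕ → R) (l : ℕ) : R[X] :=
  (linePoly d a b l).1 - X * (linePoly d a b l).2

theorem map_fixedPoly (φ : R →+* S) (d : ℕ) (a b : ℕ → R) (l : ℕ) :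
    (fixedPoly d a b l).map φ = fixedPoly d (fun i => φ (a i)) (fun i => φ (b i)) l := by
  simp [fixedPoly, ← map_linePoly φ]

theorem eval_fixedPoly (d : ℕ) (a b : ℕ → R) (l : ℕ) (z : R) :
    (fixedPoly d a b l).eval z =
      ((pairMap d a b)^[l] (z, 1)).1 - z * ((pairMap d a b)^[l] (z, 1)).2 := by
  simp [fixedPoly, ← eval_linePoly]

/-- The trace of the Jacobian matrix at `(x, y)` of an iterate of a pair of forms. -/
def jacTrace (d : ℕ) (a b : ℕ → R) (l : ℕ) (x y : R) : R :=
  ((pairMap d (fun i => C (a i)) (fun i => C (b i)))^[l] (C x + X, C y)).1.coeff 1 +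
    ((pairMap d (fun i => C (a i)) (fun i => C (b i)))^[l] (C x, C y + X)).2.coeff 1

theorem map_jacTrace (φ : R →+* S) (d : ℕ) (a b : ℕ → R) (l : ℕ) (x y : R) :
    φ (jacTrace d a b l x y) =
      jacTrace d (fun i => φ (a i)) (fun i => φ (b i)) l (φ x) (φ y) := by
  have h₁ := map_pairMap_iterate (mapRingHom φ) d (fun i => C (a i)) (fun i => C (b i)) l
    (C x + X, C y)
  have h₂ := map_pairMap_iterate (mapRingHom φ) d (fun i => C (a i)) (fun i => C (b i)) l
    (C x, C y + X)
  simp only [coe_mapRingHom, map_C, Prod.map, Polynomial.map_add, map_X] at h₁ h₂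
  rw [jacTrace, jacTrace, ← h₁, ← h₂]
  simp

end PairMap

/-! ### Linear changes of variables in complex binary forms -/

section IsForm

/-- A function of two complex variables given by a binary form of degree `n`. -/
def IsForm (n : ℕ) (g : ℂ × ℂ → ℂ) : Prop :=
  ∃ a : ℕ → ℂ, ∀ v, g v = evalForm n a v.1 v.2

theorem IsForm.add {n : ℕ} {g h : ℂ × ℂ → ℂ} (hg : IsForm n g) (hh : IsForm n h) :
    IsForm n fun v => g v + h v := by
  obtain ⟨a, ha⟩ := hg
  obtain ⟨b, hb⟩ := hh
  refine ⟨fun i => a i + b i, fun v => ?_⟩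
  simp only [ha, hb, evalForm, add_mul, sum_add_distrib]

theorem IsForm.const_mul {n : ℕ} {g : ℂ × ℂ → ℂ} (c : ℂ) (hg : IsForm n g) :
    IsForm n fun v => c * g v := by
  obtain ⟨a, ha⟩ := hg
  refine ⟨fun i => c * a i, fun v => ?_⟩
  simp only [ha, evalForm, mul_assoc, mul_sum]

theorem isForm_zero (n : ℕ) : IsForm n fun _ => 0 := ⟨fun _ => 0, fun v => by simp [evalForm]⟩

theorem IsForm.sum {n : ℕ} {ι : Type*} (s : Finset ι) {g : ι → ℂ × ℂ → ℂ}
    (hg : ∀ i ∈ s, IsForm n (g i)) : IsForm n fun v => ∑ i ∈ s, g i v := by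
  classical
  induction s using Finset.induction_on with
  | empty => simpa using isForm_zero n
  | insert i s hi ih =>
    simp only [sum_insert hi]
    exact (hg i (mem_insert_self i s)).add (ih fun j hj => hg j (mem_insert_of_mem hj))

theorem IsForm.fst_mul {n : ℕ} {g : ℂ × ℂ → ℂ} (hg : IsForm n g) :
    IsForm (n + 1) fun v => v.1 * g v := by
  obtain ⟨a, ha⟩ := hg
  refine ⟨fun i => if i = 0 then 0 else a (i - 1), fun v => ?_⟩
  rw [evalForm, sum_range_succ']
  simp only [ha, evalForm, mul_sum]
  simp only [Nat.add_eq_zero_iff, one_ne_zero, and_false, if_false, if_true, Nat.add_sub_cancel,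
    zero_mul, add_zero, Nat.add_sub_add_right]
  exact sum_congr rfl fun i _ => by ring

theorem IsForm.snd_mul {n : ℕ} {g : ℂ × ℂ → ℂ} (hg : IsForm n g) :
    IsForm (n + 1) fun v => v.2 * g v := by
  obtain ⟨a, ha⟩ := hg
  refine ⟨fun i => if i = n + 1 then 0 else a i, fun v => ?_⟩
  rw [evalForm, sum_range_succ]
  simp only [ha, evalForm, mul_sum, if_true, zero_mul, add_zero]
  refine sum_congr rfl fun i hi => ?_
  have hi' := mem_range.1 hi
  rw [if_neg (by omega), show n + 1 - i = n - i + 1 by omega]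
  ring

theorem IsForm.linear_mul {n : ℕ} {g : ℂ × ℂ → ℂ} (hg : IsForm n g) (p q : ℂ) :
    IsForm (n + 1) fun v => (p * v.1 + q * v.2) * g v := by
  convert (hg.fst_mul.const_mul p).add (hg.snd_mul.const_mul q) using 2 with v
  ring

theorem isForm_pow_mul_pow (p q r s : ℂ) (m k : ℕ) :
    IsForm (m + k) fun v => (p * v.1 + q * v.2) ^ m * (r * v.1 + s * v.2) ^ k := by
  induction m with
  | zero =>
    induction k with
    | zero => exact ⟨fun _ => 1, fun v => by simp [evalForm]⟩
    | succ k ih =>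
      rw [← add_assoc]
      convert ih.linear_mul r s using 2 with v
      ring
  | succ m ih =>
    rw [show m + 1 + k = m + k + 1 by omega]
    convert ih.linear_mul p q using 2 with v
    ring

theorem isForm_evalForm_linear (d : ℕ) (a : ℕ → ℂ) (p q r s : ℂ) :
    IsForm d fun v => evalForm d a (p * v.1 + q * v.2) (r * v.1 + s * v.2) := by
  refine IsForm.sum _ fun i hi => ?_
  have hi' : i + (d - i) = d := Nat.add_sub_cancel' (Nat.lt_succ_iff.1 (mem_range.1 hi))
  have := (isForm_pow_mul_pow p q r s i (d - i)).const_mul (a i)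
  rw [hi'] at this
  simpa only [mul_assoc] using this

theorem linear_prod_apply (M : (ℂ × ℂ) →ₗ[ℂ] ℂ × ℂ) (v : ℂ × ℂ) :
    M v = ((M (1, 0)).1 * v.1 + (M (0, 1)).1 * v.2, (M (1, 0)).2 * v.1 + (M (0, 1)).2 * v.2) := by
  have : v = v.1 • ((1 : ℂ), (0 : ℂ)) + v.2 • ((0 : ℂ), (1 : ℂ)) := by ext <;> simp
  conv_lhs => rw [this, map_add, map_smul, map_smul]
  ext <;> simp [mul_comm]

/-- Conjugating a pair of forms by a linear automorphism gives a pair of forms. -/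
theorem exists_conj_pairMap (d : ℕ) (a b : ℕ → ℂ) (M : (ℂ × ℂ) ≃ₗ[ℂ] ℂ × ℂ) :
    ∃ a' b' : ℕ → ℂ, ∀ v, pairMap d a' b' v = M.symm (pairMap d a b (M v)) := by
  have key : ∀ c : ℕ → ℂ, IsForm d fun v => evalForm d c (M v).1 (M v).2 := fun c => by
    have := isForm_evalForm_linear d c (M (1, 0)).1 (M (0, 1)).1 (M (1, 0)).2 (M (0, 1)).2
    convert this using 3 with v
    · exact congrArg Prod.fst (linear_prod_apply M.toLinearMap v)
    · exact congrArg Prod.snd (linear_prod_apply M.toLinearMap v)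
  obtain ⟨a', ha'⟩ := ((key a).const_mul (M.symm (1, 0)).1).add
    ((key b).const_mul (M.symm (0, 1)).1)
  obtain ⟨b', hb'⟩ := ((key a).const_mul (M.symm (1, 0)).2).add
    ((key b).const_mul (M.symm (0, 1)).2)
  refine ⟨a', b', fun v => ?_⟩
  have := linear_prod_apply M.symm.toLinearMap (pairMap d a b (M v))
  simp only [LinearEquiv.coe_coe] at this
  rw [this]
  exact Prod.ext (ha' v).symm (hb' v).symm

end IsForm

end

section

open Finset Polynomial

/-! ### Multipliers read off from homogeneous lifts -/

section Multiplier

/-- Binary forms `P`, `Q` without common zero in `ℂ² \ {0}`. -/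
def NoCommonZero (d : ℕ) (a b : ℕ → ℂ) : Prop := ∀ v, pairMap d a b v = 0 → v = 0

theorem NoCommonZero.iterate {d : ℕ} {a b : ℕ → ℂ} (h : NoCommonZero d a b) (l : ℕ) {v : ℂ × ℂ}
    (hv : (pairMap d a b)^[l] v = 0) : v = 0 := by
  induction l generalizing v with
  | zero => simpa using hv
  | succ l ih =>
    rw [Function.iterate_succ_apply] at hv
    exact h v (ih hv)

theorem differentiable_pairMap (d : ℕ) (a b : ℕ → ℂ) : Differentiable ℂ (pairMap d a b) := by
  unfold pairMap evalForm
  fun_prop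

theorem differentiable_pairMap_iterate (d : ℕ) (a b : ℕ → ℂ) (l : ℕ) :
    Differentiable ℂ (pairMap d a b)^[l] :=
  (differentiable_pairMap d a b).iterate l

theorem trace_prod_eq (L : (ℂ × ℂ) →ₗ[ℂ] ℂ × ℂ) :
    LinearMap.trace ℂ (ℂ × ℂ) L = (L (1, 0)).1 + (L (0, 1)).2 := by
  rw [LinearMap.trace_eq_matrix_trace ℂ (Module.Basis.finTwoProd ℂ), Matrix.trace_fin_two]
  simp [LinearMap.toMatrix_apply]

theorem hasDerivAt_fst_line {F : ℂ × ℂ → ℂ × ℂ} {L : (ℂ × ℂ) →L[ℂ] ℂ × ℂ} {x y : ℂ}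
    (h : HasFDerivAt F L (x, y)) : HasDerivAt (fun t => F (t, y)) (L (1, 0)) x :=
  h.comp_hasDerivAt (f := fun t : ℂ => (t, y)) x ((hasDerivAt_id x).prodMk (hasDerivAt_const x y))

theorem hasDerivAt_snd_line {F : ℂ × ℂ → ℂ × ℂ} {L : (ℂ × ℂ) →L[ℂ] ℂ × ℂ} {x y : ℂ}
    (h : HasFDerivAt F L (x, y)) : HasDerivAt (fun t => F (x, t)) (L (0, 1)) y :=
  h.comp_hasDerivAt (f := fun t : ℂ => (x, t)) y ((hasDerivAt_const y x).prodMk (hasDerivAt_id y))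

theorem hasDerivAt_fst_comp {g : ℂ → ℂ × ℂ} {g' : ℂ × ℂ} {x : ℂ} (h : HasDerivAt g g' x) :
    HasDerivAt (fun t => (g t).1) g'.1 x :=
  (ContinuousLinearMap.fst ℂ ℂ ℂ).hasFDerivAt.comp_hasDerivAt x h

theorem hasDerivAt_snd_comp {g : ℂ → ℂ × ℂ} {g' : ℂ × ℂ} {x : ℂ} (h : HasDerivAt g g' x) :
    HasDerivAt (fun t => (g t).2) g'.2 x :=
  (ContinuousLinearMap.snd ℂ ℂ ℂ).hasFDerivAt.comp_hasDerivAt x h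

theorem coeff_one_eq_of_hasDerivAt {p : ℂ[X]} {g : ℂ → ℂ} {x g' : ℂ}
    (hp : ∀ t, p.eval t = g (x + t)) (h : HasDerivAt g g' x) : p.coeff 1 = g' := by
  have h₁ : HasDerivAt (fun t => p.eval t) (p.derivative.eval 0) 0 := p.hasDerivAt 0
  have h₂ : HasDerivAt (fun t => p.eval t) g' 0 := by
    simp only [hp]
    exact HasDerivAt.comp_const_add (f := g) x 0 (by simpa using h)
  rw [h₂.unique h₁, ← coeff_zero_eq_eval_zero, coeff_derivative]
  simp

/-- The linear coefficient of a polynomial in `t` is its derivative at `0`, so the analytic trace is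
a purely algebraic expression, which makes sense for germs too. -/
theorem trace_eq_jacTrace {d : ℕ} {a b : ℕ → ℂ} {l : ℕ} {L : (ℂ × ℂ) →L[ℂ] ℂ × ℂ} {v : ℂ × ℂ}
    (h : HasFDerivAt (pairMap d a b)^[l] L v) :
    LinearMap.trace ℂ (ℂ × ℂ) L.toLinearMap = jacTrace d a b l v.1 v.2 := by
  obtain ⟨x, y⟩ := v
  have key : ∀ (t : ℂ) (u : ℂ[X] × ℂ[X]),
      (((pairMap d (fun i => C (a i)) (fun i => C (b i)))^[l] u).1.eval t,
        ((pairMap d (fun i => C (a i)) (fun i => C (b i)))^[l] u).2.eval t) =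
        (pairMap d a b)^[l] (u.1.eval t, u.2.eval t) := fun t u => by
    simpa [Prod.map] using
      map_pairMap_iterate (evalRingHom t) d (fun i => C (a i)) (fun i => C (b i)) l u
  rw [trace_prod_eq, jacTrace]
  congr 1
  · refine (coeff_one_eq_of_hasDerivAt (g := fun t => ((pairMap d a b)^[l] (t, y)).1) (x := x)
      (fun t => ?_) (hasDerivAt_fst_comp (hasDerivAt_fst_line h))).symm
    have := congrArg Prod.fst (key t (C x + X, C y))
    rwa [show (C x + X : ℂ[X]).eval t = x + t by simp, eval_C] at this
  · refine (coeff_one_eq_of_hasDerivAt (g := fun t => ((pairMap d a b)^[l] (x, t)).2) (x := y)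
      (fun t => ?_) (hasDerivAt_snd_comp (hasDerivAt_snd_line h))).symm
    have := congrArg Prod.snd (key t (C x, C y + X))
    rwa [show (C y + X : ℂ[X]).eval t = y + t by simp, eval_C] at this

/-- For a homogeneous self-map `F` of `ℂ²` of degree `D`, `ρ` is the multiplier of the induced
self-map of the sphere at the fixed point `[v]`. -/
def IsMultiplierAt (F : ℂ × ℂ → ℂ × ℂ) (D : ℕ) (ρ : ℂ) (v : ℂ × ℂ) : Prop :=
  ∃ (μ : ℂ) (L : (ℂ × ℂ) →L[ℂ] ℂ × ℂ), v ≠ 0 ∧ μ ≠ 0 ∧ F v = μ • v ∧ HasFDerivAt F L v ∧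
    LinearMap.trace ℂ (ℂ × ℂ) L.toLinearMap = μ * (D + ρ)

/-- The chain rule conjugates the differential by `M`, and the trace is invariant under conjugation.
-/
theorem IsMultiplierAt.conj {F G : ℂ × ℂ → ℂ × ℂ} {D : ℕ} {ρ : ℂ} {v : ℂ × ℂ}
    (h : IsMultiplierAt F D ρ v) (M : (ℂ × ℂ) ≃L[ℂ] ℂ × ℂ) (hG : ∀ u, G u = M.symm (F (M u))) :
    IsMultiplierAt G D ρ (M.symm v) := by
  obtain ⟨μ, L, hv, hμ, hF, hL, htr⟩ := h
  refine ⟨μ, (M.symm : (ℂ × ℂ) →L[ℂ] ℂ × ℂ) ∘L L ∘L (M : (ℂ × ℂ) →L[ℂ] ℂ × ℂ), by simpa using hv,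
    hμ, by simp [hG, hF], ?_, ?_⟩
  · rw [funext hG]
    have hL' : HasFDerivAt F L (M (M.symm v)) := by simpa using hL
    exact (M.symm.hasFDerivAt).comp (M.symm v) (hL'.comp (M.symm v) M.hasFDerivAt)
  · rw [← htr, ← LinearMap.trace_conj' L.toLinearMap M.symm.toLinearEquiv]
    rfl

theorem IsMultiplierAt.smul {F : ℂ × ℂ → ℂ × ℂ} {D : ℕ} {ρ : ℂ} {v : ℂ × ℂ}
    (h : IsMultiplierAt F (D + 1) ρ v) (hF : ∀ (s : ℂ) u, F (s • u) = s ^ (D + 1) • F u) {s : ℂ}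
    (hs : s ≠ 0) : IsMultiplierAt F (D + 1) ρ (s • v) := by
  obtain ⟨μ, L, hv, hμ, hFv, hL, htr⟩ := h
  refine ⟨s ^ D * μ, s ^ D • L, by simp [hs, hv], by simp [hs, hμ], ?_, ?_, ?_⟩
  · rw [hF, hFv, smul_smul, smul_smul]
    congr 1
    ring
  · have h₁ : F = fun u => s ^ (D + 1) • F (s⁻¹ • u) := by
      funext u
      rw [← hF, smul_smul, mul_inv_cancel₀ hs, one_smul]
    have h₂ : HasFDerivAt (fun u : ℂ × ℂ => s⁻¹ • u) (s⁻¹ • ContinuousLinearMap.id ℂ (ℂ × ℂ))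
        (s • v) := (hasFDerivAt_id (𝕜 := ℂ) (s • v)).const_smul s⁻¹
    have h₃ : HasFDerivAt F L (s⁻¹ • s • v) := by
      rwa [smul_smul, inv_mul_cancel₀ hs, one_smul]
    have h₄ : HasFDerivAt (fun u => s ^ (D + 1) • F (s⁻¹ • u))
        (s ^ (D + 1) • L ∘L (s⁻¹ • ContinuousLinearMap.id ℂ (ℂ × ℂ))) (s • v) :=
      (h₃.comp (s • v) h₂).const_smul (s ^ (D + 1))
    have h₅ : s ^ (D + 1) • L ∘L (s⁻¹ • ContinuousLinearMap.id ℂ (ℂ × ℂ)) = s ^ D • L := by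
      rw [ContinuousLinearMap.comp_smul, ContinuousLinearMap.comp_id, smul_smul, pow_succ,
        mul_inv_cancel_right₀ hs]
    rw [h₁, ← h₅]
    exact h₄
  · have : (s ^ D • L).toLinearMap = s ^ D • L.toLinearMap := rfl
    rw [this, map_smul, htr, smul_eq_mul]
    ring

/-- Euler's identity for homogeneous maps. -/
theorem hasFDerivAt_apply_self {F : ℂ × ℂ → ℂ × ℂ} {D : ℕ} {v : ℂ × ℂ}
    {L : (ℂ × ℂ) →L[ℂ] ℂ × ℂ} (hL : HasFDerivAt F L v)
    (hF : ∀ (s : ℂ) u, F (s • u) = s ^ D • F u) : L v = (D : ℂ) • F v := by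
  have h₁ : HasDerivAt (fun s : ℂ => s • v) v 1 := by
    simpa using (hasDerivAt_id (1 : ℂ)).smul_const v
  have h₂ : HasDerivAt (fun s : ℂ => F (s • v)) (L v) 1 :=
    HasFDerivAt.comp_hasDerivAt (f := fun s : ℂ => s • v) 1 (by simpa using hL) h₁
  have h₃ : HasDerivAt (fun s : ℂ => F (s • v)) ((D : ℂ) • F v) 1 := by
    simp only [hF]
    simpa using (hasDerivAt_pow D (1 : ℂ)).smul_const (F v)
  exact h₂.unique h₃

/-- By Euler's identity the differential has eigenvector `v = (z, 1)` with eigenvalue `D μ`. On the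
quotient by the line of `v` it acts as `μ ρ`, the action on the tangent space of the sphere being
rescaled by `μ`. The trace is the sum of the two. -/
theorem isMultiplierAt_of_snd_eq_one {F : ℂ × ℂ → ℂ × ℂ} {D : ℕ} {z μ : ℂ}
    (hd : DifferentiableAt ℂ F (z, 1)) (hF : ∀ (s : ℂ) u, F (s • u) = s ^ D • F u) (hμ : μ ≠ 0)
    (hz : F (z, 1) = μ • (z, 1)) :
    IsMultiplierAt F D (deriv (fun w => (F (w, 1)).1 / (F (w, 1)).2) z) (z, 1) := by
  obtain ⟨L, hL⟩ := hd
  refine ⟨μ, L, by simp, hμ, hz, hL, ?_⟩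
  have hE := hasFDerivAt_apply_self hL hF
  have hline := hasDerivAt_fst_line hL
  have h1 : (F (z, 1)).1 = μ * z := by simp [hz]
  have h2 : (F (z, 1)).2 = μ := by simp [hz]
  have hdiv := (hasDerivAt_fst_comp hline).div (hasDerivAt_snd_comp hline) (by rw [h2]; exact hμ)
  simp only [Pi.div_def] at hdiv
  rw [hdiv.deriv, h1, h2, trace_prod_eq]
  have hL2 := congrArg Prod.snd ((linear_prod_apply L.toLinearMap (z, 1)).symm.trans hE)
  simp only [Prod.smul_snd, h2, smul_eq_mul, ContinuousLinearMap.coe_coe] at hL2 ⊢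
  field_simp
  linear_combination hL2

theorem isMultiplierAt_one_zero {F : ℂ × ℂ → ℂ × ℂ} {D : ℕ} {μ : ℂ}
    (hd : DifferentiableAt ℂ F (1, 0)) (hF : ∀ (s : ℂ) u, F (s • u) = s ^ D • F u) (hμ : μ ≠ 0)
    (hz : F (1, 0) = μ • (1, 0)) :
    IsMultiplierAt F D (deriv (fun w => (F (1, w)).2 / (F (1, w)).1) 0) (1, 0) := by
  obtain ⟨L, hL⟩ := hd
  refine ⟨μ, L, by simp, hμ, hz, hL, ?_⟩
  have hE := hasFDerivAt_apply_self hL hF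
  have hline := hasDerivAt_snd_line hL
  have h1 : (F (1, 0)).1 = μ := by simp [hz]
  have h2 : (F (1, 0)).2 = 0 := by simp [hz]
  have hdiv := (hasDerivAt_snd_comp hline).div (hasDerivAt_fst_comp hline) (by rw [h1]; exact hμ)
  simp only [Pi.div_def] at hdiv
  rw [hdiv.deriv, h1, h2, trace_prod_eq]
  have hL1 := congrArg Prod.fst hE
  simp only [Prod.smul_fst, h1, smul_eq_mul, ContinuousLinearMap.coe_coe] at hL1 ⊢
  field_simp
  linear_combination μ * hL1

end Multiplier

/-! ### From self-maps of the sphere to homogeneous lifts -/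

section Sphere

/-- Extension by zero of the coefficients of a binary form. -/
def extendCoeffs {d : ℕ} (a : Fin (d + 1) → ℂ) (i : ℕ) : ℂ :=
  if h : i < d + 1 then a ⟨i, h⟩ else 0

theorem eval_form {d : ℕ} (a : Fin (d + 1) → ℂ) (v : Fin 2 → ℂ) :
    MvPolynomial.eval v (form a) = evalForm d (extendCoeffs a) (v 0) (v 1) := by
  rw [evalForm, ← Fin.sum_univ_eq_sum_range
    (fun i => extendCoeffs a i * v 0 ^ i * v 1 ^ (d - i))]
  simp only [form, extendCoeffs, Fin.is_lt, dif_pos, Fin.eta, map_sum, map_mul, map_pow,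
    MvPolynomial.eval_C, MvPolynomial.eval_X]

/-- Substituting `x = z y` in the form gives its value at `(z, 1)` times `y^d`, which is zero.
Subtracting this expression term by term leaves differences `x^i - (z y)^i`, each divisible by `x -
z y`. -/
theorem linear_dvd_form {d : ℕ} (a : Fin (d + 1) → ℂ) (z : ℂ)
    (h : evalForm d (extendCoeffs a) z 1 = 0) :
    MvPolynomial.X 0 - MvPolynomial.C z * MvPolynomial.X 1 ∣ form a := by
  have h₀ : (MvPolynomial.C (evalForm d (extendCoeffs a) z 1) * MvPolynomial.X 1 ^ d :
      MvPolynomial (Fin 2) ℂ) = ∑ i : Fin (d + 1), MvPolynomial.C (a i) *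
        (MvPolynomial.C z * MvPolynomial.X 1) ^ (i : ℕ) * MvPolynomial.X 1 ^ (d - (i : ℕ)) := by
    rw [evalForm, ← Fin.sum_univ_eq_sum_range (fun i => extendCoeffs a i * z ^ i * 1 ^ (d - i)),
      map_sum, sum_mul]
    refine sum_congr rfl fun i _ => ?_
    have hi : (i : ℕ) + (d - i) = d := Nat.add_sub_cancel' (Nat.lt_succ_iff.1 i.2)
    simp only [extendCoeffs, i.2, dif_pos, one_pow, mul_one, map_mul, map_pow, Fin.eta, mul_pow]
    have hX : (MvPolynomial.X 1 : MvPolynomial (Fin 2) ℂ) ^ d =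
        MvPolynomial.X 1 ^ (i : ℕ) * MvPolynomial.X 1 ^ (d - (i : ℕ)) := by
      rw [← pow_add, hi]
    rw [hX]
    ring
  rw [h, map_zero, zero_mul] at h₀
  rw [← sub_zero (form a), h₀, form, ← sum_sub_distrib]
  refine dvd_sum fun i _ => ?_
  rw [← sub_mul, ← mul_sub]
  exact ((sub_dvd_pow_sub_pow _ _ _).mul_left _).mul_right _

theorem X_one_dvd_form {d : ℕ} (a : Fin (d + 1) → ℂ) (h : extendCoeffs a d = 0) :
    MvPolynomial.X 1 ∣ form a := by
  refine dvd_sum fun i _ => ?_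
  by_cases hi : (i : ℕ) = d
  · have : a i = 0 := by
      rw [← h, extendCoeffs, dif_pos (Nat.lt_succ_self d)]
      congr 1
      exact Fin.ext hi
    simp [this]
  · exact (dvd_pow_self _ (by have := i.2; omega)).mul_left _

/-- A common zero yields a common linear factor. Coprimality makes it a unit, yet it vanishes at the
zero. -/
theorem noCommonZero_of_isRelPrime {d : ℕ} {a b : Fin (d + 1) → ℂ}
    (h : IsRelPrime (form a) (form b)) :
    NoCommonZero d (extendCoeffs a) (extendCoeffs b) := by
  rintro ⟨x, y⟩ hv
  have ha : evalForm d (extendCoeffs a) x y = 0 := congrArg Prod.fst hv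
  have hb : evalForm d (extendCoeffs b) x y = 0 := congrArg Prod.snd hv
  by_contra hne
  by_cases hy : y = 0
  · subst hy
    have hx : x ≠ 0 := fun hx => hne (by simp [hx])
    have key : ∀ c : ℕ → ℂ, evalForm d c x 0 = 0 → c d = 0 := fun c hc => by
      have := evalForm_smul d c x 1 0
      rw [mul_one, mul_zero, hc, evalForm_one_zero] at this
      simpa [hx] using this.symm
    have hu := h (X_one_dvd_form a (key _ ha)) (X_one_dvd_form b (key _ hb))
    have := hu.map (MvPolynomial.eval ![1, 0])
    simp at this
  · have key : ∀ c : ℕ → ℂ, evalForm d c x y = 0 → evalForm d c (x / y) 1 = 0 := fun c hc => by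
      have := evalForm_smul d c y (x / y) 1
      rw [mul_div_cancel₀ _ hy, mul_one, hc] at this
      simpa [hy] using this.symm
    have hu := h (linear_dvd_form a _ (key _ ha)) (linear_dvd_form b _ (key _ hb))
    have := hu.map (MvPolynomial.eval ![x / y, 1])
    simp at this

/-- Homogeneous coordinates as an element of `ℂ × ℂ`. -/
def homogPair (p : OnePoint ℂ) : ℂ × ℂ := (homog p 0, homog p 1)

theorem homogPair_infty : homogPair OnePoint.infty = (1, 0) := rfl

theorem homogPair_coe (z : ℂ) : homogPair (z : OnePoint ℂ) = (z, 1) := rfl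

theorem homogPair_ne_zero (p : OnePoint ℂ) : homogPair p ≠ 0 := by
  induction p using OnePoint.rec with
  | infty => simp [homogPair_infty]
  | coe z => simp [homogPair_coe]

theorem point_smul {s : ℂ} (hs : s ≠ 0) (v : ℂ × ℂ) :
    point (s • v).1 (s • v).2 = point v.1 v.2 := by
  simp [point, hs, mul_div_mul_left]

theorem point_homogPair (p : OnePoint ℂ) : point (homogPair p).1 (homogPair p).2 = p := by
  induction p using OnePoint.rec with
  | infty => simp [homogPair_infty, point]
  | coe z => simp [homogPair_coe, point]

theorem exists_smul_homogPair_point {v : ℂ × ℂ} (hv : v ≠ 0) :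
    ∃ s : ℂ, s ≠ 0 ∧ v = s • homogPair (point v.1 v.2) := by
  obtain ⟨x, y⟩ := v
  by_cases hy : y = 0
  · subst hy
    exact ⟨x, fun hx => hv (by simp [hx]), by simp [point, homogPair_infty]⟩
  · exact ⟨y, hy, by simp [point, hy, homogPair_coe, mul_div_cancel₀]⟩

theorem coord_point (x y : ℂ) : coord (point x y) = x / y := by
  by_cases hy : y = 0 <;> simp [point, hy, coord]

theorem coordInfty_point (x y : ℂ) : coordInfty (point x y) = y / x := by
  by_cases hy : y = 0 <;> simp [point, hy, coordInfty]

variable {d : ℕ} (c : CoprimePair d)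

/-- The homogeneous lift of a rational map. -/
def CoprimePair.lift : ℂ × ℂ → ℂ × ℂ := pairMap d (extendCoeffs c.1.1) (extendCoeffs c.1.2)

theorem CoprimePair.noCommonZero : NoCommonZero d (extendCoeffs c.1.1) (extendCoeffs c.1.2) :=
  noCommonZero_of_isRelPrime c.2

theorem CoprimePair.toFun_point {v : ℂ × ℂ} (hv : v ≠ 0) :
    c.toFun (point v.1 v.2) = point (c.lift v).1 (c.lift v).2 := by
  obtain ⟨s, hs, h⟩ := exists_smul_homogPair_point hv
  conv_rhs => rw [h, CoprimePair.lift, pairMap_smul, point_smul (pow_ne_zero d hs)]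
  simp only [CoprimePair.toFun, eval_form]
  rfl

theorem CoprimePair.iterate_toFun_point (l : ℕ) {v : ℂ × ℂ} (hv : v ≠ 0) :
    c.toFun^[l] (point v.1 v.2) = point (c.lift^[l] v).1 (c.lift^[l] v).2 := by
  induction l generalizing v with
  | zero => rfl
  | succ l ih =>
    rw [Function.iterate_succ_apply, Function.iterate_succ_apply, c.toFun_point hv,
      ih (v := c.lift v) fun h => hv (c.noCommonZero v h)]

/-- The derivative in charts at a periodic point is the multiplier of the homogeneous lift. -/
theorem CoprimePair.isMultiplierAt {l : ℕ} {p : OnePoint ℂ}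
    (hp : Function.IsPeriodicPt c.toFun l p) :
    IsMultiplierAt c.lift^[l] (d ^ l) (derivAtFixedPt c.toFun^[l] p) (homogPair p) := by
  have hd : Differentiable ℂ c.lift^[l] := differentiable_pairMap_iterate _ _ _ _
  have hF : ∀ (s : ℂ) u, c.lift^[l] (s • u) = s ^ d ^ l • c.lift^[l] u :=
    pairMap_iterate_smul _ _ _ _
  obtain ⟨μ, hμ, h⟩ := exists_smul_homogPair_point (v := c.lift^[l] (homogPair p))
    fun h => homogPair_ne_zero p (c.noCommonZero.iterate l h)
  rw [← c.iterate_toFun_point l (homogPair_ne_zero p), point_homogPair, hp] at h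
  induction p using OnePoint.rec with
  | infty =>
    have : ∀ w : ℂ, coordInfty (c.toFun^[l] (point 1 w)) =
        (c.lift^[l] (1, w)).2 / (c.lift^[l] (1, w)).1 := fun w => by
      rw [c.iterate_toFun_point l (v := (1, w)) (by simp), coordInfty_point]
    simp only [derivAtFixedPt, OnePoint.elim_infty, this]
    exact isMultiplierAt_one_zero (hd _) hF hμ h
  | coe z =>
    have : ∀ w : ℂ, coord (c.toFun^[l] (point w 1)) =
        (c.lift^[l] (w, 1)).1 / (c.lift^[l] (w, 1)).2 := fun w => by
      rw [c.iterate_toFun_point l (v := (w, 1)) (by simp), coord_point]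
    simp only [derivAtFixedPt, OnePoint.elim_some, this]
    exact isMultiplierAt_of_snd_eq_one (hd _) hF hμ h

end Sphere

end

section

open Finset Polynomial

/-! ### Normal forms under conjugacy -/

section NormalForm

theorem coeff_evalForm_X_one {R : Type*} [CommRing R] (d : ℕ) (a : ℕ → R) (j : ℕ) :
    (evalForm d (fun i => C (a i)) X 1).coeff j = if j ≤ d then a j else 0 := by
  simp [evalForm, coeff_X_pow]

theorem coeff_fixedPoly_one {R : Type*} [CommRing R] {d : ℕ} (a b : ℕ → R) {j : ℕ} (hj : j ≤ d) :
    (fixedPoly d a b 1).coeff j = a j - if j = 0 then 0 else b (j - 1) := by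
  cases j with
  | zero => simp [fixedPoly, linePoly, pairMap, coeff_evalForm_X_one]
  | succ j =>
    have : j ≤ d := by omega
    simp [fixedPoly, linePoly, pairMap, coeff_evalForm_X_one, hj, this]

theorem coeff_fixedPoly_one_succ {R : Type*} [CommRing R] (d : ℕ) (a b : ℕ → R) :
    (fixedPoly d a b 1).coeff (d + 1) = -b d := by
  simp [fixedPoly, linePoly, pairMap, coeff_evalForm_X_one]

theorem natDegree_fixedPoly_one_le {R : Type*} [CommRing R] (d : ℕ) (a b : ℕ → R) :
    (fixedPoly d a b 1).natDegree ≤ d + 1 := by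
  refine natDegree_le_iff_coeff_eq_zero.2 fun j hj => ?_
  cases j with
  | zero => omega
  | succ j =>
    simp [fixedPoly, linePoly, pairMap, coeff_evalForm_X_one, show ¬ j + 1 ≤ d by omega,
      show ¬ j ≤ d by omega]

theorem eq_smul_of_isRoot_fixedPoly_one {d : ℕ} {a b : ℕ → ℂ} {z : ℂ}
    (h : (fixedPoly d a b 1).IsRoot z) : ∃ μ : ℂ, pairMap d a b (z, 1) = μ • (z, 1) := by
  rw [IsRoot, eval_fixedPoly, Function.iterate_one] at h
  refine ⟨(pairMap d a b (z, 1)).2, Prod.ext ?_ ?_⟩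
  · simp only [Prod.smul_fst, smul_eq_mul]
    linear_combination h
  · simp

/-- Either `∞` is fixed, or the fixed point polynomial has a non-zero coefficient in degree `d + 1`
and therefore a root. -/
theorem exists_fixed_vector (d : ℕ) (a b : ℕ → ℂ) :
    ∃ u : ℂ × ℂ, u ≠ 0 ∧ ∃ μ : ℂ, pairMap d a b u = μ • u := by
  by_cases hb : b d = 0
  · exact ⟨(1, 0), by simp, a d, by simp [pairMap, evalForm_one_zero, hb]⟩
  · have hdeg : (fixedPoly d a b 1).degree ≠ 0 := fun h => by
      have := coeff_eq_zero_of_degree_lt (p := fixedPoly d a b 1) (n := d + 1)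
        (by rw [h]; exact_mod_cast d.succ_pos)
      rw [coeff_fixedPoly_one_succ] at this
      exact hb (neg_eq_zero.1 this)
    obtain ⟨z, hz⟩ := IsAlgClosed.exists_root _ hdeg
    exact ⟨(z, 1), by simp, eq_smul_of_isRoot_fixedPoly_one hz⟩

/-- The determinant of two vectors of `ℂ²`. -/
def det₂ (u w : ℂ × ℂ) : ℂ := u.1 * w.2 - u.2 * w.1

theorem exists_det₂_ne_zero {u : ℂ × ℂ} (hu : u ≠ 0) : ∃ w, det₂ u w ≠ 0 := by
  by_cases h : u.1 = 0
  · refine ⟨(1, 0), fun h' => hu (Prod.ext h ?_)⟩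
    simpa [det₂] using h'
  · exact ⟨(0, 1), by simpa [det₂] using h⟩

theorem exists_linearEquiv_of_det₂_ne_zero {u w : ℂ × ℂ} (h : det₂ u w ≠ 0) :
    ∃ M : (ℂ × ℂ) ≃ₗ[ℂ] ℂ × ℂ, ∀ v, M v = v.1 • u + v.2 • w := by
  let f : (ℂ × ℂ) →ₗ[ℂ] ℂ × ℂ :=
    (LinearMap.fst ℂ ℂ ℂ).smulRight u + (LinearMap.snd ℂ ℂ ℂ).smulRight w
  have hf : ∀ v, f v = v.1 • u + v.2 • w := fun v => rfl
  have hinj : Function.Injective f := by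
    rw [injective_iff_map_eq_zero]
    intro v hv
    rw [hf] at hv
    have h₁ := congrArg Prod.fst hv
    have h₂ := congrArg Prod.snd hv
    simp only [Prod.fst_add, Prod.snd_add, Prod.smul_fst, Prod.smul_snd, smul_eq_mul,
      Prod.fst_zero, Prod.snd_zero] at h₁ h₂
    refine Prod.ext ((mul_eq_zero.1 ?_).resolve_right h) ((mul_eq_zero.1 ?_).resolve_right h)
    · simp only [det₂]
      linear_combination w.2 * h₁ - w.1 * h₂
    · simp only [det₂]
      linear_combination u.1 * h₂ - u.2 * h₁
  exact ⟨LinearEquiv.ofInjectiveEndo f hinj, fun v => hf v⟩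

/-- Either there are three distinct fixed points, or all the fixed points are among two points of
the sphere one of which is fixed. -/
theorem fixed_vectors_dichotomy (d : ℕ) (a b : ℕ → ℂ) :
    (∃ u₁ u₂ u₃ : ℂ × ℂ, (∃ μ : ℂ, pairMap d a b u₁ = μ • u₁) ∧
      (∃ μ : ℂ, pairMap d a b u₂ = μ • u₂) ∧ (∃ μ : ℂ, pairMap d a b u₃ = μ • u₃) ∧
      det₂ u₁ u₂ ≠ 0 ∧ det₂ u₁ u₃ ≠ 0 ∧ det₂ u₂ u₃ ≠ 0) ∨
    ∃ u₁ u₂ : ℂ × ℂ, (∃ μ : ℂ, pairMap d a b u₁ = μ • u₁) ∧ det₂ u₁ u₂ ≠ 0 ∧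
      ∀ w, (∃ μ : ℂ, pairMap d a b w = μ • w) → det₂ u₁ w = 0 ∨ det₂ u₂ w = 0 := by
  obtain ⟨u₁, hu₁, hfix₁⟩ := exists_fixed_vector d a b
  by_cases h₂ : ∃ u₂, (∃ μ : ℂ, pairMap d a b u₂ = μ • u₂) ∧ det₂ u₁ u₂ ≠ 0
  · obtain ⟨u₂, hfix₂, hdet⟩ := h₂
    by_cases h₃ : ∃ u₃, (∃ μ : ℂ, pairMap d a b u₃ = μ • u₃) ∧ det₂ u₁ u₃ ≠ 0 ∧ det₂ u₂ u₃ ≠ 0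
    · obtain ⟨u₃, hfix₃, h₁₃, h₂₃⟩ := h₃
      exact Or.inl ⟨u₁, u₂, u₃, hfix₁, hfix₂, hfix₃, hdet, h₁₃, h₂₃⟩
    · refine Or.inr ⟨u₁, u₂, hfix₁, hdet, fun w hw => ?_⟩
      by_contra! hc
      exact h₃ ⟨w, hw, hc⟩
  · obtain ⟨w, hw⟩ := exists_det₂_ne_zero hu₁
    refine Or.inr ⟨u₁, w, hfix₁, hw, fun v hv => Or.inl ?_⟩
    by_contra hc
    exact h₂ ⟨v, hv, hc⟩

/-- The map `[x : y] ↦ [P : Q]` fixes `0`, `1` (and `∞`). -/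
def FixesZeroOne {R : Type*} [CommRing R] (d : ℕ) (a b : ℕ → R) : Prop :=
  a 0 = 0 ∧ ∑ i ∈ range (d + 1), a i = ∑ i ∈ range (d + 1), b i

/-- The form `y P - x Q` is a monomial `c x^k y^(d+1-k)`. -/
def FixedFormMonomial {R : Type*} [CommRing R] (d k : ℕ) (a b : ℕ → R) : Prop :=
  ∃ c : R, ∀ j ≤ d, a j = (if j = 0 then 0 else b (j - 1)) + if j = k then c else 0

theorem eq_C_mul_X_pow_of_roots {p : ℂ[X]} (h : ∀ z, p.IsRoot z → z = 0) :
    p = C p.leadingCoeff * X ^ p.natDegree := by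
  have hs := IsAlgClosed.splits p
  have h0 : p.roots = Multiset.replicate p.natDegree 0 := by
    rw [Multiset.eq_replicate]
    refine ⟨hs.natDegree_eq_card_roots.symm, fun z hz => h z (isRoot_of_mem_roots hz)⟩
  have := hs.eq_prod_roots
  rw [h0] at this
  simpa using this

/-- Three distinct fixed points can be moved to `∞`, `0`, `1`. If there are fewer, a fixed point is
moved to `∞` and any other one to `0`; the fixed point polynomial then has no root but `0`, so it is
a monomial. -/
theorem exists_conj_fixing {d : ℕ} {a b : ℕ → ℂ} (h : NoCommonZero d a b) :
    ∃ (M : (ℂ × ℂ) ≃ₗ[ℂ] ℂ × ℂ) (a' b' : ℕ → ℂ),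
      (∀ v, pairMap d a' b' v = M.symm (pairMap d a b (M v))) ∧ a' d ≠ 0 ∧ b' d = 0 ∧
      (FixesZeroOne d a' b' ∨ ∃ k ≤ d + 1, FixedFormMonomial d k a' b') := by
  have hfix : ∀ (M : (ℂ × ℂ) ≃ₗ[ℂ] ℂ × ℂ) (a' b' : ℕ → ℂ),
      (∀ v, pairMap d a' b' v = M.symm (pairMap d a b (M v))) → ∀ v (μ : ℂ),
      pairMap d a' b' v = μ • v ↔ pairMap d a b (M v) = μ • M v := by
    intro M a' b' hM v μ
    rw [hM, LinearEquiv.symm_apply_eq, map_smul]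
  have htop : ∀ (M : (ℂ × ℂ) ≃ₗ[ℂ] ℂ × ℂ) (a' b' : ℕ → ℂ),
      (∀ v, pairMap d a' b' v = M.symm (pairMap d a b (M v))) →
      (∃ μ : ℂ, pairMap d a b (M (1, 0)) = μ • M (1, 0)) → a' d ≠ 0 ∧ b' d = 0 := by
    rintro M a' b' hM ⟨μ, hμ⟩
    have h₁ := (hfix M a' b' hM (1, 0) μ).2 hμ
    have hb : b' d = 0 := by
      simpa [pairMap, evalForm_one_zero] using congrArg Prod.snd h₁
    refine ⟨fun ha => ?_, hb⟩
    have h₂ : pairMap d a' b' (1, 0) = 0 := by simp [pairMap, evalForm_one_zero, ha, hb]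
    rw [hM, LinearEquiv.map_eq_zero_iff] at h₂
    simpa using h _ h₂
  rcases fixed_vectors_dichotomy d a b with
    ⟨u₁, u₂, u₃, ⟨μ₁, h₁⟩, ⟨μ₂, h₂⟩, ⟨μ₃, h₃⟩, h₁₂, h₁₃, h₂₃⟩ | ⟨u₁, u₂, ⟨μ₁, h₁⟩, h₁₂, hall⟩
  · obtain ⟨M, hM⟩ := exists_linearEquiv_of_det₂_ne_zero
      (u := -det₂ u₂ u₃ • u₁) (w := det₂ u₁ u₃ • u₂) (by
        have : det₂ (-det₂ u₂ u₃ • u₁) (det₂ u₁ u₃ • u₂) =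
            -det₂ u₂ u₃ * det₂ u₁ u₃ * det₂ u₁ u₂ := by
          simp only [det₂, Prod.smul_fst, Prod.smul_snd, smul_eq_mul]
          ring
        rw [this]
        exact mul_ne_zero (mul_ne_zero (neg_ne_zero.2 h₂₃) h₁₃) h₁₂)
    obtain ⟨a', b', hab⟩ := exists_conj_pairMap d a b M
    have hM₁ : M (1, 0) = -det₂ u₂ u₃ • u₁ := by simp [hM]
    have hM₂ : M (0, 1) = det₂ u₁ u₃ • u₂ := by simp [hM]
    have hM₃ : M (1, 1) = det₂ u₁ u₂ • u₃ := by
      rw [hM]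
      ext <;> simp only [det₂, Prod.fst_add, Prod.snd_add, Prod.smul_fst, Prod.smul_snd,
        smul_eq_mul] <;> ring
    have hsmul : ∀ (s : ℂ) (u : ℂ × ℂ) (μ : ℂ), pairMap d a b u = μ • u →
        ∃ ν : ℂ, pairMap d a b (s • u) = ν • (s • u) ∨ s = 0 := by
      intro s u μ hu
      by_cases hs : s = 0
      · exact ⟨0, Or.inr hs⟩
      · refine ⟨s ^ d * μ * s⁻¹, Or.inl ?_⟩
        rw [pairMap_smul, hu, smul_smul, smul_smul, inv_mul_cancel_right₀ hs]
    obtain ⟨ν₁, hν₁⟩ := hsmul (-det₂ u₂ u₃) u₁ μ₁ h₁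
    obtain ⟨ν₂, hν₂⟩ := hsmul (det₂ u₁ u₃) u₂ μ₂ h₂
    obtain ⟨ν₃, hν₃⟩ := hsmul (det₂ u₁ u₂) u₃ μ₃ h₃
    replace hν₁ := hν₁.resolve_right (neg_ne_zero.2 h₂₃)
    replace hν₂ := hν₂.resolve_right h₁₃
    replace hν₃ := hν₃.resolve_right h₁₂
    rw [← hM₁] at hν₁
    rw [← hM₂, ← hfix M a' b' hab] at hν₂
    rw [← hM₃, ← hfix M a' b' hab] at hν₃
    obtain ⟨ha, hb⟩ := htop M a' b' hab ⟨ν₁, hν₁⟩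
    refine ⟨M, a', b', hab, ha, hb, Or.inl ⟨?_, ?_⟩⟩
    · simpa [pairMap, evalForm_zero_one] using congrArg Prod.fst hν₂
    · have h₁ := congrArg Prod.fst hν₃
      have h₂ := congrArg Prod.snd hν₃
      simp only [pairMap, evalForm, one_pow, mul_one, Prod.smul_fst, Prod.smul_snd,
        smul_eq_mul] at h₁ h₂
      rw [h₁, h₂]
  · obtain ⟨M, hM⟩ := exists_linearEquiv_of_det₂_ne_zero h₁₂
    obtain ⟨a', b', hab⟩ := exists_conj_pairMap d a b M
    have hM₁ : M (1, 0) = u₁ := by simp [hM]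
    obtain ⟨ha, hb⟩ := htop M a' b' hab ⟨μ₁, by rw [hM₁, h₁]⟩
    have hroot : ∀ z, (fixedPoly d a' b' 1).IsRoot z → z = 0 := fun z hz => by
      obtain ⟨μ, hμ⟩ := eq_smul_of_isRoot_fixedPoly_one hz
      rw [hfix M a' b' hab] at hμ
      have hd₁ : det₂ u₁ (M (z, 1)) = det₂ u₁ u₂ := by
        rw [hM]
        simp only [det₂, Prod.fst_add, Prod.snd_add, Prod.smul_fst, Prod.smul_snd, smul_eq_mul]
        ring
      have hd₂ : det₂ u₂ (M (z, 1)) = -(z * det₂ u₁ u₂) := by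
        rw [hM]
        simp only [det₂, Prod.fst_add, Prod.snd_add, Prod.smul_fst, Prod.smul_snd, smul_eq_mul]
        ring
      rcases hall _ ⟨μ, hμ⟩ with hw | hw
      · exact absurd (hd₁.symm.trans hw) h₁₂
      · rw [hd₂, neg_eq_zero] at hw
        exact (mul_eq_zero.1 hw).resolve_right h₁₂
    refine ⟨M, a', b', hab, ha, hb, Or.inr ⟨_, natDegree_fixedPoly_one_le d a' b',
      (fixedPoly d a' b' 1).leadingCoeff, fun j hj => ?_⟩⟩
    have h₁ := coeff_fixedPoly_one a' b' hj
    rw [eq_C_mul_X_pow_of_roots hroot, coeff_C_mul_X_pow] at h₁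
    rw [h₁]
    ring

/-- Every rational map of degree `d ≥ 2` is conjugate to one in normal form. -/
theorem exists_conj_normalForm {d : ℕ} (hd : 2 ≤ d) {a b : ℕ → ℂ} (h : NoCommonZero d a b) :
    ∃ (M : (ℂ × ℂ) ≃ₗ[ℂ] ℂ × ℂ) (a' b' : ℕ → ℂ),
      (∀ v, pairMap d a' b' v = M.symm (pairMap d a b (M v))) ∧ a' d = 1 ∧ b' d = 0 ∧
      (FixesZeroOne d a' b' ∨ ∃ k ≤ d + 1, FixedFormMonomial d k a' b') := by
  obtain ⟨M, a', b', hab, ha, hb, hcases⟩ := exists_conj_fixing h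
  -- Conjugating by the homothety of ratio `t` multiplies a lift of degree `d` by `t^(d-1)`, which
  -- makes it possible to normalize the leading coefficient to `1`.
  obtain ⟨t, ht⟩ := IsAlgClosed.exists_pow_nat_eq (a' d)⁻¹ (n := d - 1) (by omega)
  have ht0 : t ≠ 0 := by
    rintro rfl
    rw [zero_pow (by omega)] at ht
    exact inv_ne_zero ha ht.symm
  refine ⟨(LinearEquiv.smulOfNeZero ℂ (ℂ × ℂ) t ht0).trans M, fun i => (a' d)⁻¹ * a' i,
    fun i => (a' d)⁻¹ * b' i, fun v => ?_, inv_mul_cancel₀ ha, by simp [hb], ?_⟩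
  · have h₁ : ((LinearEquiv.smulOfNeZero ℂ (ℂ × ℂ) t ht0).trans M).symm
        (pairMap d a b (((LinearEquiv.smulOfNeZero ℂ (ℂ × ℂ) t ht0).trans M) v)) =
        (LinearEquiv.smulOfNeZero ℂ (ℂ × ℂ) t ht0).symm (pairMap d a' b' (t • v)) := by
      rw [hab]
      rfl
    rw [h₁, eq_comm, LinearEquiv.symm_apply_eq, pairMap_smul]
    have h₂ : pairMap d (fun i => (a' d)⁻¹ * a' i) (fun i => (a' d)⁻¹ * b' i) v =
        t ^ (d - 1) • pairMap d a' b' v := by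
      simp only [pairMap, evalForm, ht, mul_assoc, ← mul_sum, Prod.smul_mk, smul_eq_mul]
    rw [h₂, LinearEquiv.smulOfNeZero_apply, smul_smul, ← pow_succ', Nat.sub_add_cancel (by omega)]
  · rcases hcases with ⟨h₀, h₁⟩ | ⟨k, hk, c, hc⟩
    · exact Or.inl ⟨by simp [h₀], by rw [← mul_sum, ← mul_sum, h₁]⟩
    · refine Or.inr ⟨k, hk, (a' d)⁻¹ * c, fun j hj => ?_⟩
      simp only [hc j hj]
      split_ifs <;> simp [mul_add]

end NormalForm

/-! ### Counting the parameters of a normal form -/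

section Generators

variable {K : Type*} [Field K]

/-- The coefficients of a map in normal form are generated by `2d - 2` elements. -/
theorem exists_generators {d : ℕ} (hd : 2 ≤ d) {a b : ℕ → K} (ha : a d = 1) (hb : b d = 0)
    (h : FixesZeroOne d a b ∨ ∃ k, FixedFormMonomial d k a b) :
    ∃ s : Finset K, s.card ≤ 2 * d - 2 ∧
      ∀ i ≤ d, a i ∈ Subring.closure (s : Set K) ∧ b i ∈ Subring.closure (s : Set K) := by
  classical
  rcases h with ⟨h₀, h₁⟩ | ⟨k, c, hc⟩
  -- The values `a 0 = 0`, `a d = 1`, `b d = 0` are known and the equality of sums determines `b 0`,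
  -- which leaves `2 (d - 1)` coefficients.
  · refine ⟨(Ico 1 d).image a ∪ (Ico 1 d).image b, ?_, ?_⟩
    · refine (card_union_le _ _).trans ?_
      have h₂ := card_image_le (s := Ico 1 d) (f := a)
      have h₃ := card_image_le (s := Ico 1 d) (f := b)
      rw [Nat.card_Ico] at h₂ h₃
      omega
    · set A := Subring.closure
        (((Ico 1 d).image a ∪ (Ico 1 d).image b : Finset K) : Set K) with hA
      have ha' : ∀ i ≤ d, a i ∈ A := fun i hi => by
        rcases Nat.eq_zero_or_pos i with rfl | hpos
        · rw [h₀]; exact A.zero_mem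
        · rcases hi.eq_or_lt with rfl | hlt
          · rw [ha]; exact A.one_mem
          · exact Subring.subset_closure (by
              rw [mem_coe, mem_union]
              exact Or.inl (mem_image_of_mem _ (mem_Ico.2 ⟨hpos, hlt⟩)))
      have hb' : ∀ i, 0 < i → i ≤ d → b i ∈ A := fun i hpos hi => by
        rcases hi.eq_or_lt with rfl | hlt
        · rw [hb]; exact A.zero_mem
        · exact Subring.subset_closure (by
            rw [mem_coe, mem_union]
            exact Or.inr (mem_image_of_mem _ (mem_Ico.2 ⟨hpos, hlt⟩)))
      refine fun i hi => ⟨ha' i hi, ?_⟩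
      rcases Nat.eq_zero_or_pos i with rfl | hpos
      · rw [sum_range_succ' b] at h₁
        rw [← sub_eq_iff_eq_add'.2 h₁]
        refine A.sub_mem (A.sum_mem fun i hi => ha' i (Nat.lt_succ_iff.1 (mem_range.1 hi)))
          (A.sum_mem fun i hi => hb' _ i.succ_pos (mem_range.1 hi))
      · exact hb' i hpos hi
  -- Every `a j` comes from `b` and `c`, and `a d = 1` determines `b (d - 1)`. This leaves `c` and
  -- `b 0, …, b (d - 2)`: at most `d ≤ 2d - 2` generators.
  · refine ⟨insert c ((range (d - 1)).image b), ?_, ?_⟩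
    · refine (card_insert_le _ _).trans ?_
      have h₂ := card_image_le (s := range (d - 1)) (f := b)
      rw [card_range] at h₂
      omega
    · set A := Subring.closure ((insert c ((range (d - 1)).image b) : Finset K) : Set K) with hA
      have hcA : c ∈ A := Subring.subset_closure (by simp)
      have hite : ∀ j, (if j = k then c else 0) ∈ A := fun j => by
        split_ifs
        exacts [hcA, A.zero_mem]
      have hb' : ∀ i ≤ d, b i ∈ A := fun i hi => by
        rcases lt_trichotomy i (d - 1) with hlt | heq | hgt
        · exact Subring.subset_closure (by
            rw [mem_coe, mem_insert]
            exact Or.inr (mem_image_of_mem _ (mem_range.2 hlt)))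
        · have := hc d le_rfl
          rw [ha, if_neg (by omega), ← heq] at this
          rw [← sub_eq_iff_eq_add.2 this]
          exact A.sub_mem A.one_mem (hite d)
        · rw [show i = d by omega, hb]
          exact A.zero_mem
      refine fun i hi => ⟨?_, hb' i hi⟩
      rw [hc i hi]
      refine A.add_mem ?_ (hite i)
      split_ifs
      exacts [A.zero_mem, hb' _ (by omega)]

end Generators

end

/-! ### Algebraicity of multipliers in the field of germs -/

section

open Finset Polynomial Filter

/-- No iterate of a rational map of degree at least two is the identity. -/
theorem fixedPoly_ne_zero {d : ℕ} (hd : 2 ≤ d) {a b : ℕ → ℂ} (h : NoCommonZero d a b) {l : ℕ}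
    (hl : 1 ≤ l) : fixedPoly d a b l ≠ 0 := by
  intro h0
  -- If every `z` were fixed, `(z, 1)` would be multiplied by a polynomial in `z`. This polynomial
  -- has no root, because the lift has no non-trivial zero, so it is a constant `c`.
  have hline : ∀ z, (pairMap d a b)^[l] (z, 1) = (linePoly d a b l).2.eval z • (z, 1) := fun z => by
    have h₁ := eval_linePoly d a b l z
    have h₂ := eval_fixedPoly d a b l z
    rw [h0, eval_zero, ← h₁] at h₂
    rw [← h₁]
    ext
    · simp only [Prod.smul_fst, smul_eq_mul]
      linear_combination -h₂
    · simp
  have hdeg : (linePoly d a b l).2.degree = 0 := by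
    by_contra hne
    obtain ⟨z, hz⟩ := IsAlgClosed.exists_root _ hne
    have := h.iterate l (v := (z, 1)) (by rw [hline, hz.eq_zero, zero_smul])
    simp at this
  obtain ⟨c, hc⟩ : ∃ c, (linePoly d a b l).2 = C c := ⟨_, eq_C_of_degree_eq_zero hdeg⟩
  simp only [hc, eval_C] at hline
  have hD : 2 ≤ d ^ l := hd.trans (Nat.le_self_pow (by omega) d)
  -- By homogeneity the eigenvalue at `(1, y)` is `c y^(d^l - 1)`. It tends to `0` with `y` since
  -- `d^l ≥ 2`, which forces a zero of the iterate at `(1, 0)`.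
  have hy : ∀ y : ℂ, y ≠ 0 → (pairMap d a b)^[l] (1, y) = (y ^ (d ^ l - 1) * c) • (1, y) := by
    intro y hy
    have h₁ : ((1 : ℂ), y) = y • (y⁻¹, 1) := by simp [hy]
    conv_lhs => rw [h₁, pairMap_iterate_smul, hline]
    conv_rhs => rw [h₁]
    rw [smul_smul, smul_smul]
    congr 1
    conv_lhs => rw [← Nat.sub_add_cancel (show 1 ≤ d ^ l by omega), pow_succ]
    ring
  have ht₁ : Tendsto (fun y : ℂ => (pairMap d a b)^[l] (1, y)) (nhdsWithin 0 {0}ᶜ)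
      (nhds ((pairMap d a b)^[l] (1, 0))) := by
    refine tendsto_nhdsWithin_of_tendsto_nhds (Continuous.tendsto ?_ 0)
    exact (differentiable_pairMap_iterate d a b l).continuous.comp (by fun_prop)
  have ht₂ : Tendsto (fun y : ℂ => (y ^ (d ^ l - 1) * c) • ((1 : ℂ), y)) (nhdsWithin 0 {0}ᶜ)
      (nhds 0) := by
    refine tendsto_nhdsWithin_of_tendsto_nhds ?_
    have : Continuous fun y : ℂ => (y ^ (d ^ l - 1) * c) • ((1 : ℂ), y) := by fun_prop
    convert this.tendsto 0 using 2
    rw [zero_pow (by omega), zero_mul, zero_smul]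
  have heq : (pairMap d a b)^[l] (1, 0) = 0 :=
    tendsto_nhds_unique_of_eventuallyEq ht₁ ht₂
      (eventually_nhdsWithin_of_forall fun y hy' => hy y hy')
  simpa using h.iterate l heq

theorem IsMultiplierAt.exists_normalized {d : ℕ} (hd : 1 ≤ d) {a b : ℕ → ℂ} {l : ℕ} {ρ : ℂ}
    {v : ℂ × ℂ} (h : IsMultiplierAt (pairMap d a b)^[l] (d ^ l) ρ v) :
    ∃ w : ℂ × ℂ, IsMultiplierAt (pairMap d a b)^[l] (d ^ l) ρ w ∧ (w = (1, 0) ∨ w.2 = 1) := by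
  have hv : v ≠ 0 := by obtain ⟨_, _, hv, _⟩ := h; exact hv
  have hD : d ^ l - 1 + 1 = d ^ l := Nat.sub_add_cancel (Nat.one_le_pow _ _ hd)
  have key : ∀ s : ℂ, s ≠ 0 → IsMultiplierAt (pairMap d a b)^[l] (d ^ l) ρ (s • v) := by
    intro s hs
    rw [← hD] at h ⊢
    exact h.smul (by rw [hD]; exact pairMap_iterate_smul d a b l) hs
  by_cases h2 : v.2 = 0
  · have h1 : v.1 ≠ 0 := fun h1 => hv (Prod.ext h1 h2)
    exact ⟨_, key v.1⁻¹ (inv_ne_zero h1), Or.inl (by ext <;> simp [h1, h2])⟩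
  · exact ⟨_, key v.2⁻¹ (inv_ne_zero h2), Or.inr (by simp [h2])⟩

section Germ

variable (ω : Ultrafilter ℕ)

instance charZero_germ : CharZero (Germ (ω : Filter ℕ) ℂ) :=
  charZero_of_injective_ringHom
    ((Germ.coeRingHom (ω : Filter ℕ)).comp (Pi.constRingHom ℕ ℂ)).injective

variable {ω}

theorem coeRingHom_eq_zero_iff {x : ℕ → ℂ} :
    Germ.coeRingHom (ω : Filter ℕ) x = 0 ↔ ∀ᶠ n in (ω : Filter ℕ), x n = 0 :=
  Germ.coe_eq

/-- If the polynomial vanished over the germs, its finitely many coefficients would vanish together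
at some index `n`, contradicting `fixedPoly_ne_zero` for the `n`-th map. -/
theorem fixedPoly_germ_ne_zero {d : ℕ} (hd : 2 ≤ d) {a b : ℕ → ℕ → ℂ}
    (h : ∀ n, NoCommonZero d (fun i => a i n) (fun i => b i n)) {l : ℕ} (hl : 1 ≤ l) :
    fixedPoly d (fun i => Germ.coeRingHom (ω : Filter ℕ) (a i))
      (fun i => Germ.coeRingHom (ω : Filter ℕ) (b i)) l ≠ 0 := by
  rw [← map_fixedPoly]
  intro h0
  have hcoeff : ∀ i ∈ (fixedPoly d a b l).support,
      ∀ᶠ n in (ω : Filter ℕ), (fixedPoly d a b l).coeff i n = 0 := fun i _ => by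
    rw [← coeRingHom_eq_zero_iff, ← coeff_map, h0, coeff_zero]
  obtain ⟨n, hn⟩ := ((Filter.eventually_all_finset _).2 hcoeff).exists
  refine fixedPoly_ne_zero hd (h n) hl ?_
  have := map_fixedPoly (Pi.evalRingHom (fun _ : ℕ => ℂ) n) d a b l
  simp only [Pi.evalRingHom_apply] at this
  rw [← this]
  ext i
  rw [coeff_map, coeff_zero, Pi.evalRingHom_apply]
  by_cases hi : i ∈ (fixedPoly d a b l).support
  · exact hn i hi
  · rw [notMem_support_iff.1 hi, Pi.zero_apply]

theorem inv_mem_of_algebraically_closed {K : Type*} [Field K] {S : Subalgebra ℤ K}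
    (hS : ∀ x : K, IsAlgebraic S x → x ∈ S) {x : K} (hx : x ∈ S) : x⁻¹ ∈ S :=
  hS _ (IsAlgebraic.inv (isAlgebraic_algebraMap (⟨x, hx⟩ : S)))

/-- Multipliers of periodic points are algebraic over the coefficients. -/
theorem multiplier_germ_mem {d : ℕ} (hd : 2 ≤ d) {a b : ℕ → ℕ → ℂ}
    (h : ∀ n, NoCommonZero d (fun i => a i n) (fun i => b i n)) {l : ℕ} (hl : 1 ≤ l)
    {ρ : ℕ → ℂ} (hρ : ∀ n, ∃ v,
      IsMultiplierAt (pairMap d (fun i => a i n) (fun i => b i n))^[l] (d ^ l) (ρ n) v)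
    {S : Subalgebra ℤ (Germ (ω : Filter ℕ) ℂ)}
    (hS : ∀ x : Germ (ω : Filter ℕ) ℂ, IsAlgebraic S x → x ∈ S)
    (ha : ∀ i, Germ.coeRingHom (ω : Filter ℕ) (a i) ∈ S)
    (hb : ∀ i, Germ.coeRingHom (ω : Filter ℕ) (b i) ∈ S) :
    Germ.coeRingHom (ω : Filter ℕ) ρ ∈ S := by
  set ψ := Germ.coeRingHom (R := ℂ) (ω : Filter ℕ) with hψ
  -- Periodic vectors are rescaled to `(1, 0)` or `(x, 1)`: an arbitrary rescaling would destroy the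
  -- algebraicity of their coordinates.
  have hρ' := fun n => (hρ n).choose_spec.exists_normalized (by omega)
  choose v hv hnorm using hρ'
  choose μ L _ hμ hfix hL htr using hv
  set x : ℕ → ℂ := fun n => (v n).1 with hx
  set y : ℕ → ℂ := fun n => (v n).2 with hy
  have hfixR : (pairMap d a b)^[l] (x, y) = (μ * x, μ * y) := by
    have key : ∀ n, Prod.map (Pi.evalRingHom (fun _ : ℕ => ℂ) n) (Pi.evalRingHom (fun _ => ℂ) n)
        ((pairMap d a b)^[l] (x, y)) = μ n • v n := fun n => by
      rw [map_pairMap_iterate]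
      exact hfix n
    refine Prod.ext (funext fun n => ?_) (funext fun n => ?_)
    · exact congrArg Prod.fst (key n)
    · exact congrArg Prod.snd (key n)
  have hjacR : jacTrace d a b l x y = μ * (((d ^ l : ℕ) : ℕ → ℂ) + ρ) := by
    funext n
    have := map_jacTrace (Pi.evalRingHom (fun _ : ℕ => ℂ) n) d a b l x y
    simp only [Pi.evalRingHom_apply] at this
    rw [this, hx, hy, ← trace_eq_jacTrace (hL n), htr]
    simp
  have hfixψ := map_pairMap_iterate ψ d a b l (x, y)
  rw [hfixR] at hfixψ
  simp only [Prod.map, map_mul] at hfixψ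
  have hjacψ := congrArg ψ hjacR
  rw [map_jacTrace, map_mul, map_add, map_natCast] at hjacψ
  have hμψ : ψ μ ≠ 0 := fun h0 => by
    obtain ⟨n, hn⟩ := (coeRingHom_eq_zero_iff.1 h0).exists
    exact hμ n hn
  set aS : ℕ → S := fun i => ⟨ψ (a i), ha i⟩
  set bS : ℕ → S := fun i => ⟨ψ (b i), hb i⟩
  have hpair : ∀ p q : S, ((pairMap d (fun i => ψ (a i)) (fun i => ψ (b i)))^[l]
      ((p : Germ (ω : Filter ℕ) ℂ), (q : Germ (ω : Filter ℕ) ℂ))).1 ∈ S ∧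
      ((pairMap d (fun i => ψ (a i)) (fun i => ψ (b i)))^[l]
      ((p : Germ (ω : Filter ℕ) ℂ), (q : Germ (ω : Filter ℕ) ℂ))).2 ∈ S := fun p q => by
    have := map_pairMap_iterate (algebraMap S (Germ (ω : Filter ℕ) ℂ)) d aS bS l (p, q)
    constructor
    · exact (congrArg Prod.fst this) ▸ ((pairMap d aS bS)^[l] (p, q)).1.2
    · exact (congrArg Prod.snd this) ▸ ((pairMap d aS bS)^[l] (p, q)).2.2
  have hxy : ψ x ∈ S ∧ ψ y ∈ S ∧ ψ μ ∈ S := by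
    rcases Ultrafilter.eventually_or.1 (Eventually.of_forall (f := (ω : Filter ℕ)) hnorm)
      with hcase | hcase
    · have hx1 : ψ x = 1 := by
        rw [← map_one ψ, ← sub_eq_zero, ← map_sub, coeRingHom_eq_zero_iff]
        filter_upwards [hcase] with n hn
        simp [hx, hn]
      have hy0 : ψ y = 0 := by
        rw [coeRingHom_eq_zero_iff]
        filter_upwards [hcase] with n hn
        simp [hy, hn]
      have hm := (hpair 1 0).1
      rw [OneMemClass.coe_one, ZeroMemClass.coe_zero, ← hx1, ← hy0, ← hfixψ] at hm
      simp only [hx1, mul_one] at hm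
      exact ⟨hx1 ▸ S.one_mem, hy0 ▸ S.zero_mem, hm⟩
    · have hy1 : ψ y = 1 := by
        rw [← map_one ψ, ← sub_eq_zero, ← map_sub, coeRingHom_eq_zero_iff]
        filter_upwards [hcase] with n hn
        simp [hy, hn]
      -- The coordinate is a root of the fixed point polynomial, which is non-zero with coefficients
      -- in `S`.
      have hxS : ψ x ∈ S := by
        have hmap : (fixedPoly d aS bS l).map (algebraMap S (Germ (ω : Filter ℕ) ℂ)) =
            fixedPoly d (fun i => ψ (a i)) (fun i => ψ (b i)) l := map_fixedPoly _ d aS bS l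
        refine hS _ ⟨fixedPoly d aS bS l, fun h0 => ?_, ?_⟩
        · rw [h0, Polynomial.map_zero] at hmap
          exact fixedPoly_germ_ne_zero hd h hl hmap.symm
        · rw [aeval_def, ← eval_map, hmap, eval_fixedPoly]
          rw [hy1] at hfixψ
          rw [← hfixψ]
          ring
      have hm := (hpair ⟨ψ x, hxS⟩ 1).2
      rw [OneMemClass.coe_one, ← hy1, ← hfixψ] at hm
      simp only [hy1, mul_one] at hm
      exact ⟨hxS, hy1 ▸ S.one_mem, hm⟩
  obtain ⟨hxS, hyS, hμS⟩ := hxy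
  have hjacS : jacTrace d (fun i => ψ (a i)) (fun i => ψ (b i)) l (ψ x) (ψ y) ∈ S := by
    have := map_jacTrace (algebraMap S (Germ (ω : Filter ℕ) ℂ)) d aS bS l ⟨ψ x, hxS⟩ ⟨ψ y, hyS⟩
    exact this ▸ (jacTrace d aS bS l ⟨ψ x, hxS⟩ ⟨ψ y, hyS⟩).2
  -- The trace identity `tr = μ (d^l + ρ)` solved for `ρ`.
  have hρeq : ψ ρ = (ψ μ)⁻¹ * jacTrace d (fun i => ψ (a i)) (fun i => ψ (b i)) l (ψ x) (ψ y) -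
      ((d ^ l : ℕ) : Germ (ω : Filter ℕ) ℂ) := by
    rw [hjacψ, inv_mul_cancel_left₀ hμψ]
    ring
  rw [hρeq]
  exact S.sub_mem (S.mul_mem (inv_mem_of_algebraically_closed hS hμS) hjacS) (natCast_mem S _)

end Germ

end

section

open Finset Filter

/-! ### Incomparable growth and algebraic independence -/

section Growth

variable {ω : Ultrafilter ℕ} {ι : Type*} {Λ : ι → ℕ → ℝ}

/-- Among finitely many sequences with pairwise distinct growth, one dominates the others. -/
theorem exists_dominating (hΛ : ∀ i, Tendsto (Λ i) ω atTop)
    (hne : ∀ i j, i ≠ j → ¬∃ c : ℝ, 0 < c ∧ Tendsto (fun n => Λ i n / Λ j n) ω (nhds c))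
    {s : Finset ι} (hs : s.Nonempty) :
    ∃ j ∈ s, ∀ i ∈ s, i ≠ j → Tendsto (fun n => Λ i n / Λ j n) ω (nhds 0) := by
  have hmax : ∀ᶠ n in (ω : Filter ℕ), ∃ j ∈ (s : Set ι), ∀ i ∈ s, Λ i n ≤ Λ j n :=
    Eventually.of_forall fun n => s.exists_max_image (fun i => Λ i n) hs
  -- The index of the maximum depends on `n`, but takes finitely many values, so `ω` selects one.
  obtain ⟨j, hj, hjmax⟩ := (Ultrafilter.eventually_exists_mem_iff s.finite_toSet).1 hmax
  refine ⟨j, hj, fun i hi hij => ?_⟩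
  have hIcc : ∀ᶠ n in (ω : Filter ℕ), Λ i n / Λ j n ∈ Set.Icc (0 : ℝ) 1 := by
    filter_upwards [hjmax, (hΛ i).eventually_gt_atTop 0, (hΛ j).eventually_gt_atTop 0]
      with n hn hi0 hj0
    exact ⟨by positivity, (div_le_one hj0).2 (hn i hi)⟩
  obtain ⟨c, hc, hlim⟩ := isCompact_Icc.ultrafilter_le_nhds
    (ω.map fun n => Λ i n / Λ j n) (le_principal_iff.2 hIcc)
  rcases hc.1.eq_or_lt with h0 | hpos
  · rw [h0]
    exact hlim
  · exact absurd ⟨c, hpos, hlim⟩ (hne i j hij)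

/-- Among the indices with non-zero coefficient one, `j`, dominates; the sum divided by `Λ j` tends
to `m j ≠ 0`. -/
theorem tendsto_abs_sum_mul_atTop [Fintype ι] (hΛ : ∀ i, Tendsto (Λ i) ω atTop)
    (hne : ∀ i j, i ≠ j → ¬∃ c : ℝ, 0 < c ∧ Tendsto (fun n => Λ i n / Λ j n) ω (nhds c))
    {m : ι → ℝ} (hm : m ≠ 0) : Tendsto (fun n => |∑ i, m i * Λ i n|) ω atTop := by
  classical
  obtain ⟨k, hk⟩ := Function.ne_iff.1 hm
  obtain ⟨j, hj, hdom⟩ := exists_dominating hΛ hne (s := univ.filter fun i => m i ≠ 0)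
    ⟨k, by simpa using hk⟩
  have hlim : Tendsto (fun n => ∑ i, m i * (Λ i n / Λ j n)) ω (nhds (m j)) := by
    have : m j = ∑ i, if i = j then m j else 0 := by simp
    rw [this]
    refine tendsto_finsetSum _ fun i _ => ?_
    by_cases hij : i = j
    · subst hij
      rw [if_pos rfl]
      refine tendsto_const_nhds.congr' ?_
      filter_upwards [(hΛ i).eventually_gt_atTop 0] with n hn
      rw [div_self hn.ne', mul_one]
    · rw [if_neg hij]
      by_cases hi : m i = 0
      · simp [hi]
      · simpa using (hdom i (by simpa using hi) hij).const_mul (m i)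
  refine ((hΛ j).atTop_mul_pos (abs_pos.2 (mem_filter.1 hj).2) hlim.abs).congr' ?_
  filter_upwards [(hΛ j).eventually_gt_atTop 0] with n hn
  rw [← abs_of_pos hn, ← abs_mul, abs_of_pos hn, mul_sum]
  congr 1
  refine sum_congr rfl fun i _ => ?_
  field_simp

/-- Germs of sequences whose logarithms have pairwise distinct infinite growth are algebraically
independent. -/
theorem algebraicIndependent_of_growth [Fintype ι] (hΛ : ∀ i, Tendsto (Λ i) ω atTop)
    (hne : ∀ i j, i ≠ j → ¬∃ c : ℝ, 0 < c ∧ Tendsto (fun n => Λ i n / Λ j n) ω (nhds c))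
    {ρ : ι → ℕ → ℂ} {l : ι → ℝ} (hl : ∀ i, 0 < l i)
    (hρ : ∀ i, ∀ᶠ n in (ω : Filter ℕ), Real.log ‖ρ i n‖ = l i * (Λ i n - 1)) :
    AlgebraicIndependent ℤ fun i => Germ.coeRingHom (ω : Filter ℕ) (ρ i) := by
  rw [algebraicIndependent_iff]
  intro p hp
  by_contra hp0
  -- `W β n` is the logarithm of the size of the monomial with exponent `β`.
  set W : (ι →₀ ℕ) → ℕ → ℝ := fun β n => ∑ i, β i * Real.log ‖ρ i n‖ with hW
  have hρ0 : ∀ᶠ n in (ω : Filter ℕ), ∀ i, ρ i n ≠ 0 := by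
    refine eventually_all.2 fun i => ?_
    filter_upwards [hρ i, (hΛ i).eventually_gt_atTop 1] with n hn hn1 h0
    -- With the convention `log 0 = 0`, a zero of `ρ i` would give `l i * (Λ i n - 1) = 0`,
    -- impossible once `Λ i n > 1`.
    rw [h0, norm_zero, Real.log_zero] at hn
    exact (mul_pos (hl i) (sub_pos.2 hn1)).ne hn
  have hmax : ∀ᶠ n in (ω : Filter ℕ), ∃ α ∈ (p.support : Set (ι →₀ ℕ)),
      ∀ β ∈ p.support, W β n ≤ W α n :=
    Eventually.of_forall fun n =>
      p.support.exists_max_image (fun β => W β n) (MvPolynomial.support_nonempty.2 hp0)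
  obtain ⟨α, hα, hαmax⟩ :=
    (Ultrafilter.eventually_exists_mem_iff p.support.finite_toSet).1 hmax
  -- The difference of exponents is a non-zero real combination of the `Λ i`, up to the additive
  -- constant coming from `Λ i - 1`, so it is unbounded; the maximality of `α` gives its sign.
  have hW' : ∀ β ∈ p.support, β ≠ α → Tendsto (fun n => W β n - W α n) ω atBot := by
    intro β hβ hβα
    have hm : (fun i => ((α i : ℝ) - β i) * l i) ≠ 0 := fun h0 => hβα (Finsupp.ext fun i => by
      have := (mul_eq_zero.1 (congrFun h0 i)).resolve_right (hl i).ne'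
      exact_mod_cast (sub_eq_zero.1 this).symm)
    have h₁ := tendsto_abs_sum_mul_atTop hΛ hne hm
    have h₂ := tendsto_atTop_add_const_right (ω : Filter ℕ)
      (-|∑ i, ((α i : ℝ) - β i) * l i|) h₁
    rw [← tendsto_neg_atTop_iff]
    refine tendsto_atTop_mono' _ ?_ h₂
    filter_upwards [hαmax, eventually_all.2 hρ] with n hn hlog
    have h₃ : W α n - W β n = ∑ i, ((α i : ℝ) - β i) * l i * Λ i n -
        ∑ i, ((α i : ℝ) - β i) * l i := by
      rw [hW, ← sum_sub_distrib, ← sum_sub_distrib]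
      refine sum_congr rfl fun i _ => ?_
      rw [hlog i]
      ring
    rw [neg_sub, ← abs_of_nonneg (sub_nonneg.2 (hn β hβ)), h₃]
    linarith [abs_sub_abs_le_abs_sub (∑ i, ((α i : ℝ) - β i) * l i * Λ i n)
      (∑ i, ((α i : ℝ) - β i) * l i)]
  have hmono : ∀ β ∈ p.support, Tendsto
      (fun n => ((p.coeff β : ℤ) : ℂ) * ((∏ i, ρ i n ^ β i) / ∏ i, ρ i n ^ α i)) ω
      (nhds (if β = α then ((p.coeff α : ℤ) : ℂ) else 0)) := by
    intro β hβ
    by_cases hβα : β = α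
    · subst hβα
      rw [if_pos rfl]
      refine tendsto_const_nhds.congr' ?_
      filter_upwards [hρ0] with n hn
      rw [div_self (prod_ne_zero_iff.2 fun i _ => pow_ne_zero _ (hn i)), mul_one]
    · rw [if_neg hβα, ← mul_zero ((p.coeff β : ℤ) : ℂ)]
      refine Tendsto.const_mul _ ?_
      rw [tendsto_zero_iff_norm_tendsto_zero]
      refine (Real.tendsto_exp_atBot.comp (hW' β hβ hβα)).congr' ?_
      filter_upwards [hρ0] with n hn
      have hexp : ∀ γ : ι →₀ ℕ, Real.exp (W γ n) = ‖∏ i, ρ i n ^ γ i‖ := fun γ => by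
        rw [hW, Real.exp_sum, norm_prod]
        refine prod_congr rfl fun i _ => ?_
        rw [Real.exp_nat_mul, Real.exp_log (norm_pos_iff.2 (hn i)), norm_pow]
      rw [Function.comp_apply, Real.exp_sub, hexp, hexp, norm_div]
  -- Dividing the relation by the largest monomial and passing to the limit leaves its coefficient,
  -- which must then vanish.
  have hsum := tendsto_finsetSum p.support hmono
  rw [sum_ite_eq', if_pos (mem_coe.1 hα)] at hsum
  have hzero : ∀ᶠ n in (ω : Filter ℕ),
      ∑ β ∈ p.support, ((p.coeff β : ℤ) : ℂ) * ∏ i, ρ i n ^ β i = 0 := by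
    have h₁ : Germ.coeRingHom (ω : Filter ℕ)
        (∑ β ∈ p.support, ((p.coeff β : ℤ) : ℕ → ℂ) * ∏ i, ρ i ^ β i) = 0 := by
      rw [← hp, MvPolynomial.aeval_def, MvPolynomial.eval₂_eq']
      simp [map_sum, map_mul, map_prod]
    filter_upwards [coeRingHom_eq_zero_iff.1 h₁] with n hn
    simpa using hn
  have hlim0 : Tendsto (fun n => ∑ β ∈ p.support,
      ((p.coeff β : ℤ) : ℂ) * ((∏ i, ρ i n ^ β i) / ∏ i, ρ i n ^ α i)) ω (nhds 0) := by
    refine tendsto_const_nhds.congr' ?_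
    filter_upwards [hzero] with n hn
    simp only [← mul_div_assoc]
    rw [← sum_div, hn, zero_div]
  have := tendsto_nhds_unique hsum hlim0
  exact MvPolynomial.mem_support_iff.1 hα (by exact_mod_cast this)

end Growth

/-! ### The transcendence degree bound -/

section Rank

/-- Algebraically independent elements of a field which are algebraic over a finitely generated
subring are at most as many as the generators. -/
theorem card_le_of_algebraicIndependent {K : Type*} [Field K] [CharZero K] {ι : Type*} [Fintype ι]
    {x : ι → K} (hx : AlgebraicIndependent ℤ x) (s : Finset K)
    (h : ∀ S : Subalgebra ℤ K, (∀ y : K, IsAlgebraic S y → y ∈ S) → (s : Set K) ⊆ S →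
      ∀ i, x i ∈ S) : Fintype.card ι ≤ s.card := by
  set M := AlgebraicIndependent.matroid ℤ K
  -- Flats of the algebraic independence matroid are the algebraically closed subalgebras. The one
  -- spanned by `s` has rank at most `s.card` and contains the independent family.
  obtain ⟨S, hS, hclosed⟩ :=
    AlgebraicIndependent.matroid_isFlat_iff.1 (M.isFlat_closure (s : Set K))
  have hsub : Set.range x ⊆ M.closure (s : Set K) := by
    rintro _ ⟨i, rfl⟩
    rw [← hS]
    refine h S (fun y hy => ?_) ?_ i
    · have := hclosed y hy
      rwa [← hS] at this
    · rw [hS]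
      exact M.subset_closure _ (by simp [M])
  have hind : M.Indep (Set.range x) :=
    AlgebraicIndependent.matroid_indep_iff.2 hx.coe_range
  have h₁ := (hind.encard_le_eRk_of_subset hsub).trans_eq (M.eRk_closure_eq _)
  have h₂ := h₁.trans (M.eRk_le_encard _)
  rw [← Set.image_univ, hx.injective.encard_image, Set.encard_univ,
    Set.encard_coe_eq_coe_finsetCard, ENat.card_eq_coe_fintype_card] at h₂
  exact_mod_cast h₂

end Rank

/-! ### Normal forms pass to germs -/

section NormalFormGerm

variable (ω : Ultrafilter ℕ)

/-- `ω` decides which of the two forms occurs, and in the second one fixes the exponent `k` among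
`0, …, d + 1`; the constants are then chosen index by index. -/
theorem normalForm_germ {d : ℕ} {a b : ℕ → ℕ → ℂ}
    (h : ∀ n, FixesZeroOne d (fun i => a i n) (fun i => b i n) ∨
      ∃ k ≤ d + 1, FixedFormMonomial d k (fun i => a i n) (fun i => b i n)) :
    FixesZeroOne d (fun i => Germ.coeRingHom (ω : Filter ℕ) (a i))
        (fun i => Germ.coeRingHom (ω : Filter ℕ) (b i)) ∨
      ∃ k, FixedFormMonomial d k (fun i => Germ.coeRingHom (ω : Filter ℕ) (a i))
        (fun i => Germ.coeRingHom (ω : Filter ℕ) (b i)) := by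
  rcases Ultrafilter.eventually_or.1 (Eventually.of_forall (f := (ω : Filter ℕ)) h) with h | h
  · refine Or.inl ⟨?_, ?_⟩
    · rw [coeRingHom_eq_zero_iff]
      exact h.mono fun n hn => hn.1
    · rw [← map_sum, ← map_sum, ← sub_eq_zero, ← map_sub, coeRingHom_eq_zero_iff]
      filter_upwards [h] with n hn
      simp [hn.2]
  · obtain ⟨k, _, hk⟩ := (Ultrafilter.eventually_exists_mem_iff (Set.finite_Iic (d + 1))).1 h
    have hc : ∃ c : ℕ → ℂ, ∀ᶠ n in (ω : Filter ℕ), ∀ j ≤ d,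
        a j n = (if j = 0 then 0 else b (j - 1) n) + if j = k then c n else 0 :=
      hk.choice
    obtain ⟨c, hc⟩ := hc
    refine Or.inr ⟨k, Germ.coeRingHom (ω : Filter ℕ) c, fun j hj => ?_⟩
    have h₁ : Germ.coeRingHom (ω : Filter ℕ) (a j) = Germ.coeRingHom (ω : Filter ℕ)
        ((if j = 0 then 0 else b (j - 1)) + if j = k then c else 0) := by
      rw [← sub_eq_zero, ← map_sub, coeRingHom_eq_zero_iff]
      filter_upwards [hc] with n hn
      rw [Pi.sub_apply, hn j hj, Pi.add_apply]
      split_ifs <;> simp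
    refine h₁.trans ?_
    rw [map_add]
    split_ifs <;> simp

end NormalFormGerm

end

/-! ### Multiplier scales and the final count -/

section

open Finset Filter

section Scales

variable {ω : Ultrafilter ℕ}

/-- A sequence in `(0, 1]` representing a non-trivial scale tends to zero. -/
theorem tendsto_zero_of_ne_trivialScale {ε : ℕ → Set.Ioc (0 : ℝ) 1}
    (h : Quotient.mk (scaleSetoid ω) ε ≠ trivialScale ω) :
    Tendsto (fun n => (ε n : ℝ)) ω (nhds 0) := by
  obtain ⟨c, hc, hlim⟩ := isCompact_Icc.ultrafilter_le_nhds (ω.map fun n => (ε n : ℝ))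
    (le_principal_iff.2 (show ∀ᶠ n in (ω : Filter ℕ), (ε n : ℝ) ∈ Set.Icc (0 : ℝ) 1 from
      Eventually.of_forall fun n => Set.Ioc_subset_Icc_self (ε n).2))
  rcases hc.1.eq_or_lt with h0 | hpos
  · exact hlim.trans_eq (congrArg nhds h0.symm)
  · have hrel : (scaleSetoid ω).r ε fun _ => ⟨1, one_pos, le_rfl⟩ :=
      ⟨c, hpos, by
        simpa only [div_one] using (show Tendsto (fun n => (ε n : ℝ)) ω (nhds c) from hlim)⟩
    exact absurd (Quotient.sound hrel) h

theorem tendsto_atTop_of_multiplierScale_ne {d : ℕ} {f : ℕ → RatMap d} {l : ℕ}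
    {p : ℕ → OnePoint ℂ} (h : multiplierScale ω f l p ≠ trivialScale ω) :
    Tendsto (fun n => 1 + lam (f n) l (p n)) ω atTop := by
  have h₁ := tendsto_zero_of_ne_trivialScale h
  have h₂ : Tendsto (fun n => 1 / (1 + lam (f n) l (p n))) ω (nhdsWithin 0 (Set.Ioi 0)) :=
    tendsto_nhdsWithin_iff.2 ⟨h₁, Eventually.of_forall fun n => by
      have := lam_nonneg (f n) l (p n)
      exact Set.mem_Ioi.2 (by positivity)⟩
  refine h₂.inv_tendsto_nhdsGT_zero.congr fun n => ?_
  simp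

theorem not_tendsto_of_multiplierScale_ne {d : ℕ} {f : ℕ → RatMap d} {l l' : ℕ}
    {p p' : ℕ → OnePoint ℂ} (h : multiplierScale ω f l p ≠ multiplierScale ω f l' p') :
    ¬∃ c : ℝ, 0 < c ∧ Tendsto
      (fun n => (1 + lam (f n) l (p n)) / (1 + lam (f n) l' (p' n))) ω (nhds c) := by
  rintro ⟨c, hc, hlim⟩
  -- The ratio of the scales is the inverse of the ratio of the `1 + λ`, hence the exchange of
  -- roles.
  refine h (Eq.symm (Quotient.sound ⟨c, hc, hlim.congr fun n => ?_⟩))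
  simp [div_eq_inv_mul, mul_comm]

/-- Where `log⁺` is positive it equals `log`. The right-hand side has the shape `l (Λ - 1)` with `Λ
= 1 + λ` required by `algebraicIndependent_of_growth`. -/
theorem log_norm_eq_of_lam_pos {d : ℕ} {f : RatMap d} {l : ℕ} (hl : 1 ≤ l) {p : OnePoint ℂ}
    (h : 0 < lam f l p) :
    Real.log ‖derivAtFixedPt (f.1^[l]) p‖ = l * (1 + lam f l p - 1) := by
  have hl' : (0 : ℝ) < l := by exact_mod_cast hl
  have h₁ : l * lam f l p = Real.posLog ‖derivAtFixedPt (f.1^[l]) p‖ := by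
    rw [lam]
    field_simp
  rw [add_sub_cancel_left, h₁, Real.posLog, eq_comm, max_eq_right_iff]
  by_contra! hneg
  have h₂ := mul_pos hl' h
  rw [h₁, Real.posLog, max_eq_left hneg.le] at h₂
  exact lt_irrefl _ h₂

end Scales

/-- Simultaneous normal forms of a sequence of rational maps, with the same multipliers. -/
theorem exists_normalForm_sequence {d : ℕ} (hd : 2 ≤ d) (f : ℕ → RatMap d) :
    ∃ a b : ℕ → ℕ → ℂ, (∀ n, NoCommonZero d (fun i => a i n) (fun i => b i n)) ∧
      (∀ i, d < i → a i = 0 ∧ b i = 0) ∧ a d = 1 ∧ b d = 0 ∧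
      (∀ n, FixesZeroOne d (fun i => a i n) (fun i => b i n) ∨
        ∃ k ≤ d + 1, FixedFormMonomial d k (fun i => a i n) (fun i => b i n)) ∧
      ∀ n l p, Function.IsPeriodicPt (f n).1 l p → ∃ v,
        IsMultiplierAt (pairMap d (fun i => a i n) (fun i => b i n))^[l] (d ^ l)
          (derivAtFixedPt ((f n).1^[l]) p) v := by
  choose c hc using fun n => (f n).2
  choose M a b hab ha hb hform using fun n => exists_conj_normalForm hd (c n).noCommonZero
  -- Coefficients of index above `d` do not affect the map; setting them to zero puts the germs of
  -- all coefficients, whatever the index, in the ring of the generators.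
  have hcongr : ∀ n, pairMap d (fun i => if i ≤ d then a n i else 0)
      (fun i => if i ≤ d then b n i else 0) = pairMap d (a n) (b n) := fun n =>
    pairMap_congr (fun i hi => if_pos hi) (fun i hi => if_pos hi)
  refine ⟨fun i n => if i ≤ d then a n i else 0, fun i n => if i ≤ d then b n i else 0,
    fun n v hv => ?_, fun i hi => ?_, ?_, ?_, fun n => ?_, fun n l p hp => ?_⟩
  · rw [hcongr, hab, LinearEquiv.map_eq_zero_iff] at hv
    exact (LinearEquiv.map_eq_zero_iff _).1 ((c n).noCommonZero _ hv)
  · simp only [if_neg (not_le.2 hi)]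
    exact ⟨rfl, rfl⟩
  · funext n
    simp [ha]
  · funext n
    simp [hb]
  · refine (hform n).imp (fun h => ⟨by simpa using h.1, ?_⟩) ?_
    · rw [sum_congr rfl fun i hi => if_pos (Nat.lt_succ_iff.1 (mem_range.1 hi)),
        sum_congr rfl fun i hi => if_pos (Nat.lt_succ_iff.1 (mem_range.1 hi)), h.2]
    · rintro ⟨k, hk, e, he⟩
      refine ⟨k, hk, e, fun j hj => ?_⟩
      simp only [if_pos hj, if_pos ((Nat.sub_le j 1).trans hj)]
      exact he j hj
  · have hp' : Function.IsPeriodicPt (c n).toFun l p := by rwa [hc n]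
    have h₁ := (c n).isMultiplierAt hp'
    rw [hc n] at h₁
    have hsemi : Function.Semiconj (M n).symm (c n).lift (pairMap d (a n) (b n)) := fun u => by
      rw [hab, LinearEquiv.apply_symm_apply]
      rfl
    refine ⟨_, h₁.conj (M n).toContinuousLinearEquiv fun u => ?_⟩
    rw [hcongr]
    have h₂ := (hsemi.iterate_right l) (M n u)
    rw [LinearEquiv.symm_apply_apply] at h₂
    exact h₂.symm

/-- Finitely many periodic sequences with pairwise distinct non-trivial multiplier scales are at
most `2d - 2`. -/
theorem card_nontrivial_multiplierScales_le (ω : Ultrafilter ℕ) {d : ℕ} (hd : 2 ≤ d)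
    (f : ℕ → RatMap d) {ι : Type*} [Fintype ι] (l : ι → ℕ) (hl : ∀ i, 1 ≤ l i)
    (p : ι → ℕ → OnePoint ℂ) (hp : ∀ i n, Function.IsPeriodicPt (f n).1 (l i) (p i n))
    (htriv : ∀ i, multiplierScale ω f (l i) (p i) ≠ trivialScale ω)
    (hinj : Function.Injective fun i => multiplierScale ω f (l i) (p i)) :
    Fintype.card ι ≤ 2 * d - 2 := by
  obtain ⟨a, b, hNZ, htail, ha, hb, hform, hmult⟩ := exists_normalForm_sequence hd f
  set ψ := Germ.coeRingHom (R := ℂ) (ω : Filter ℕ)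
  obtain ⟨s, hs, hgen⟩ := exists_generators hd (a := fun i => ψ (a i)) (b := fun i => ψ (b i))
    (by simp only [ha, map_one]) (by simp only [hb, map_zero]) (normalForm_germ ω hform)
  have hΛ := fun i => tendsto_atTop_of_multiplierScale_ne (htriv i)
  have hind := algebraicIndependent_of_growth hΛ
    (fun i j hij => not_tendsto_of_multiplierScale_ne (hinj.ne hij))
    (ρ := fun i n => derivAtFixedPt ((f n).1^[l i]) (p i n)) (l := fun i => (l i : ℝ))
    (fun i => by exact_mod_cast hl i) (fun i => by
      filter_upwards [(hΛ i).eventually_gt_atTop 1] with n hn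
      exact log_norm_eq_of_lam_pos (hl i) (by linarith))
  refine (card_le_of_algebraicIndependent hind s fun S hS hsS i => ?_).trans hs
  have hclosure : Subring.closure (s : Set (Germ (ω : Filter ℕ) ℂ)) ≤ S.toSubring :=
    Subring.closure_le.2 hsS
  have hmem : ∀ i, ψ (a i) ∈ S ∧ ψ (b i) ∈ S := fun i => by
    by_cases hi : i ≤ d
    · exact ⟨hclosure (hgen i hi).1, hclosure (hgen i hi).2⟩
    · rw [(htail i (not_le.1 hi)).1, (htail i (not_le.1 hi)).2, map_zero]
      exact ⟨S.zero_mem, S.zero_mem⟩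
  exact multiplier_germ_mem hd hNZ (hl i) (fun n => hmult n (l i) (p i n) (hp i n)) hS
    (fun i => (hmem i).1) fun i => (hmem i).2

end

end MultiplierScales

end

theorem theoremB (ω : Ultrafilter ℕ) (hω : ∀ m : ℕ, ω ≠ pure m) (d : ℕ) (hd : 2 ≤ d)
    (f : ℕ → MultiplierScales.RatMap d) (hf : MultiplierScales.Degenerates f) :
    (MultiplierScales.multiplierScales ω f \ {MultiplierScales.trivialScale ω}).encard
        ≤ ((2 * d - 2 : ℕ) : ℕ∞) ∧
      (MultiplierScales.multiplierScales ω f).encard ≤ ((2 * d - 1 : ℕ) : ℕ∞) := by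
  have key : (MultiplierScales.multiplierScales ω f \ {MultiplierScales.trivialScale ω}).encard
      ≤ ((2 * d - 2 : ℕ) : ℕ∞) := by
    by_contra! hlt
    -- A subset of exactly `2d - 1` scales brings a possibly infinite set back to a finite family.
    obtain ⟨t, ht, htcard⟩ := Set.exists_subset_encard_eq (Order.add_one_le_of_lt hlt)
    have hfin : t.Finite :=
      Set.finite_of_encard_eq_coe (k := 2 * d - 2 + 1) (by exact_mod_cast htcard)
    have := hfin.fintype
    choose l hl p hp hsc using fun i : t => (ht i.2).1
    have hcard := MultiplierScales.card_nontrivial_multiplierScales_le ω hd f l hl p hp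
      (fun i => by rw [← hsc i]; exact (ht i.2).2)
      (fun i j hij => Subtype.ext (by rw [hsc i, hsc j]; exact hij))
    rw [Set.encard, ENat.card_eq_coe_fintype_card] at htcard
    have : Fintype.card t = 2 * d - 2 + 1 := by exact_mod_cast htcard
    omega
  refine ⟨key, ?_⟩
  have h₁ := Set.encard_le_encard_sdiff_add_encard (MultiplierScales.multiplierScales ω f)
    {MultiplierScales.trivialScale ω}
  rw [Set.encard_singleton] at h₁
  refine (h₁.trans (add_le_add_left key 1)).trans ?_
  norm_cast
  omega
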